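/- Let $H_n$ be the Hecke algebra over the field $\mathbb{C}(q)$, with generators $T_1,\dots,T_{n-1}$ and relations $(T_i-q)(T_i+q^{-1})=0$, $T_iT_{i+1}T_i=T_{i+1}T_iT_{i+1}$, and $T_iT_j=T_jT_i$ for $|i-j|>1$. For $a\neq 0$, $a\neq b$ put $$F_i(a,b)=T_i+\frac{q-q^{-1}}{a^{-1}b-1}.$$ Let $\lambda$ be a Young diagram with $n$ boxes, with rows numbered downwards and columns numbered from left to right. The hook tableau $\Lambda^\circ$ of shape $\lambda$ is obtained by writing $1,2,\dots,n$ into the boxes, principal hook after principal hook: for each $k=1,2,\dots$ with $(k,k)\in\lambda$ one first fills the column $(k,k),(k+1,k),\dots$ of the $k$-th principal hook from top to bottom and then the rest of its row $(k,k+1),(k,k+2),\dots$ from left to right. If $a$ stands in row $i$ and column $j$, let $c_a=j-i$ be its content. Put $$F_{\Lambda^\circ}(z_1,\dots,z_n)=\prod_{(i,j)}^{\rightarrow}F_{j-i}\bigl(q^{2c_i}z_i,\,q^{2c_j}z_j\bigr),$$ the product over all $1\le i<j\le n$, where $(i,j)$ stands to the left of $(i',j')$ if $j<j'$, or if $j=j'$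 and $i<i'$. The restriction of this $H_n$-valued rational function to the subspace of all $(z_1,\dots,z_n)\in\mathbb{C}(q)^n$ with $z_a=z_b$ whenever $a,b$ lie in the same principal hook of $\Lambda^\circ$ is regular at $z_1=z_2=\dots=z_n\neq 0$, and it has one well-defined value there, denoted $F_{\Lambda^\circ}\in H_n$. **Proposition.** The element $F_{\Lambda^\circ}$ is well defined in this way. Suppose further that the numbers $u<v$ stand next to each other in the same column of $\Lambda^\circ$, and let $s$ be the last entry in the row containing $u$. * If $c_v<0$, then $F_u(q^{2c_u},q^{2c_v})=T_u-q$, and $F_{\Lambda^\circ}$ is divisible on the left by it: $F_{\Lambda^\circ}=(T_u-q)\,Y$ for some $Y\in H_n$. * If $c_v\ge 0$, then $F_{\Lambda^\circ}$ is divisible on the left by the product $$\prod_{i=u,\dots,s}^{\leftarrow}\Bigl(\ \prod_{j=s+1,\dots,v}^{\rightarrow}F_{i+j-s-1}\bigl(q^{2c_i},q^{2c_j}\bigr)\Bigr),$$ that is, $F_{\Lambda^\circ}$ equals this product times some $Y\in H_n$. From left to right, $i$ decreases from $s$ to $u$ and, for each $i$, $j$ increases from $s+1$ to $v$. -/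

import Mathlib

namespace HookFusion

/-- The defining relations of the Hecke algebra `H_n` with generators `T_1, …, T_{n-1}`. -/
inductive HeckeRel {K : Type*} [Field K] (q : K) (n : ℕ) :
    FreeAlgebra K {i : ℕ // 1 ≤ i ∧ i < n} → FreeAlgebra K {i : ℕ // 1 ≤ i ∧ i < n} → Prop
  | quadratic (i : {i : ℕ // 1 ≤ i ∧ i < n}) :
      HeckeRel q n
        ((FreeAlgebra.ι K i - algebraMap K _ q) * (FreeAlgebra.ι K i + algebraMap K _ q⁻¹)) 0
  | braid (i j : {i : ℕ // 1 ≤ i ∧ i < n}) (h : (j : ℕ) = i + 1) :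
      HeckeRel q n
        (FreeAlgebra.ι K i * FreeAlgebra.ι K j * FreeAlgebra.ι K i)
        (FreeAlgebra.ι K j * FreeAlgebra.ι K i * FreeAlgebra.ι K j)
  | comm (i j : {i : ℕ // 1 ≤ i ∧ i < n}) (h : (i : ℕ) + 1 < j) :
      HeckeRel q n
        (FreeAlgebra.ι K i * FreeAlgebra.ι K j) (FreeAlgebra.ι K j * FreeAlgebra.ι K i)

/-- The Hecke algebra `H_n` over the field `K` with parameter `q`. -/
def Hecke {K : Type*} [Field K] (q : K) (n : ℕ) : Type _ := RingQuot (HeckeRel q n)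

noncomputable instance {K : Type*} [Field K] (q : K) (n : ℕ) : Ring (Hecke q n) :=
  inferInstanceAs (Ring (RingQuot (HeckeRel q n)))

noncomputable instance {K : Type*} [Field K] (q : K) (n : ℕ) : Algebra K (Hecke q n) :=
  inferInstanceAs (Algebra K (RingQuot (HeckeRel q n)))

/-- The generator `T_i` of `H_n`, for `1 ≤ i ≤ n - 1`. (The value `0` at all other indices is
a placeholder.) -/
noncomputable def T {K : Type*} [Field K] (q : K) (n i : ℕ) : Hecke q n :=
  if h : 1 ≤ i ∧ i < n then
    RingQuot.mkAlgHom K (HeckeRel q n) (FreeAlgebra.ι K ⟨i, h⟩)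
  else 0

/-- `F_i(a, b) = T_i + (q - q⁻¹) / (a⁻¹ b - 1)`, meant for `a ≠ 0` and `a ≠ b`. -/
noncomputable def factor {K : Type*} [Field K] (q : K) (n i : ℕ) (a b : K) : Hecke q n :=
  T q n i + algebraMap K (Hecke q n) ((q - q⁻¹) / (a⁻¹ * b - 1))

/-- The content `j - i` of the box `(i, j)` in row `i` and column `j`. -/
def content (b : ℕ × ℕ) : ℤ := (b.2 : ℤ) - (b.1 : ℤ)

/-- The principal hook in which the box `(i, j)` lies: the corner of that hook is the diagonal
box `(k, k)` with `k = min i j`. -/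
def hookIndex (b : ℕ × ℕ) : ℕ := min b.1 b.2

/-- The boxes of the diagram `μ` (rows and columns numbered from `0`) in the order in which the
hook tableau fills them: for each principal hook in turn, first its column `(k, k), (k+1, k), …`
from top to bottom, then the rest of its row `(k, k+1), (k, k+2), …` from left to right. Numbers
`k` for which `(k, k)` is not a box of `μ` contribute nothing. -/
def hookBoxes (μ : YoungDiagram) : List (ℕ × ℕ) :=
  (List.range μ.card).flatMap fun k =>
    (List.range' k (μ.colLen k - k)).map (fun i => (i, k)) ++
      (List.range' (k + 1) (μ.rowLen k - (k + 1))).map (fun j => (k, j))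

/-- The box of `μ` that contains the number `a` in the hook tableau of shape `μ`, for
`1 ≤ a ≤ n`, where `n` is the number of boxes of `μ`. -/
def hookBox (μ : YoungDiagram) (a : ℕ) : ℕ × ℕ := (hookBoxes μ).getD (a - 1) (0, 0)

/-- The coordinate `z_a`, `1 ≤ a ≤ n`, of `z = (z_1, …, z_n)`. -/
def coord {K : Type*} [Field K] {n : ℕ} (z : Fin n → K) (a : ℕ) : K :=
  if h : a - 1 < n then z ⟨a - 1, h⟩ else 0

/-- The argument `q^{2 c_a} z_a`, where `c_a` is the content of the box with the number `a`. -/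
noncomputable def arg {K : Type*} [Field K] (q : K) {n : ℕ} (box : ℕ → ℕ × ℕ) (z : Fin n → K)
    (a : ℕ) : K :=
  q ^ (2 * content (box a)) * coord z a

/-- The product of the factors `F_{j-i}(q^{2 c_i} z_i, q^{2 c_j} z_j)` over all pairs
`1 ≤ i < j ≤ n`, where `(i, j)` stands to the left of `(i', j')` if `j < j'`, or if `j = j'` and
`i < i'`. The tableau is given by the box `box a` of each number `a`. -/
noncomputable def fusionProduct {K : Type*} [Field K] (q : K) (n : ℕ) (box : ℕ → ℕ × ℕ)
    (z : Fin n → K) : Hecke q n :=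
  ((List.range' 1 n).map fun j =>
    ((List.range' 1 (j - 1)).map fun i =>
      factor q n (j - i) (arg q box z i) (arg q box z j)).prod).prod

/-- The tuples `(z_1, …, z_n)` with `z_a = z_b` whenever `a` and `b` are in the same principal
hook of the tableau. -/
def hookSubspace (K : Type*) [Field K] (n : ℕ) (box : ℕ → ℕ × ℕ) : Submodule K (Fin n → K) where
  carrier := {z | ∀ a b : ℕ, 1 ≤ a → a ≤ n → 1 ≤ b → b ≤ n →
    hookIndex (box a) = hookIndex (box b) → coord z a = coord z b}
  zero_mem' := by
    intro a b _ _ _ _ _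
    simp [coord]
  add_mem' := by
    intro x y hx hy a b ha ha' hb hb' h
    have h1 := hx a b ha ha' hb hb' h
    have h2 := hy a b ha ha' hb hb' h
    have ha'' : a - 1 < n := by omega
    have hb'' : b - 1 < n := by omega
    simp only [coord, ha'', hb'', dite_true, Pi.add_apply] at h1 h2 ⊢
    rw [h1, h2]
  smul_mem' := by
    intro c x hx a b ha ha' hb hb' h
    have h1 := hx a b ha ha' hb hb' h
    have ha'' : a - 1 < n := by omega
    have hb'' : b - 1 < n := by omega
    simp only [coord, ha'', hb'', dite_true, Pi.smul_apply] at h1 ⊢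
    rw [h1]

/-- The points of the hook subspace at which every factor of the fusion product is defined. -/
def regularDomain {K : Type*} [Field K] (q : K) (n : ℕ) (box : ℕ → ℕ × ℕ) : Set (Fin n → K) :=
  {z | z ∈ hookSubspace K n box ∧ ∀ i j : ℕ, 1 ≤ i → i < j → j ≤ n →
    arg q box z i ≠ 0 ∧ arg q box z i ≠ arg q box z j}

/-- On the set `U`, the `A`-valued function `f` is given by a rational function
`(∑ k, P_k • a_k) / D` (with polynomials `P_k`, `D` over `K` and `a_k ∈ A`) that is regular at
the point `p`, that is `D(p) ≠ 0`, and has the value `v` at `p`. -/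
def HasRegularValue {K ι A : Type*} [Field K] [AddCommGroup A] [Module K A]
    (U : Set (ι → K)) (f : (ι → K) → A) (p : ι → K) (v : A) : Prop :=
  ∃ (m : ℕ) (P : Fin m → MvPolynomial ι K) (a : Fin m → A) (D : MvPolynomial ι K),
    MvPolynomial.eval p D ≠ 0 ∧
    (∀ z ∈ U, MvPolynomial.eval z D • f z = ∑ k, MvPolynomial.eval z (P k) • a k) ∧
    MvPolynomial.eval p D • v = ∑ k, MvPolynomial.eval p (P k) • a k

/-- `F` is the element of `H_n` attached to the hook tableau of shape `μ`: the restriction of the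
fusion product to the hook subspace is regular on the line `z_1 = ⋯ = z_n ≠ 0` and has the value
`F` there. -/
def IsFusionElement {K : Type*} [Field K] (q : K) (μ : YoungDiagram) (F : Hecke q μ.card) : Prop :=
  ∀ t : K, t ≠ 0 →
    HasRegularValue (regularDomain q μ.card (hookBox μ)) (fusionProduct q μ.card (hookBox μ))
      (fun _ => t) F

/-- The product of the factors `F_{i+j-s-1}(q^{2 c_i}, q^{2 c_j})` over `u ≤ i ≤ s` and
`s + 1 ≤ j ≤ v` for the hook tableau of shape `μ`. From left to right `i` decreases from `s` to
`u`, and for each `i` the number `j` increases from `s + 1` to `v`. -/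
noncomputable def columnDivisor {K : Type*} [Field K] (q : K) (μ : YoungDiagram) (u v s : ℕ) :
    Hecke q μ.card :=
  ((List.range' u (s + 1 - u)).reverse.map fun i =>
    ((List.range' (s + 1) (v - s)).map fun j =>
      factor q μ.card (i + j - s - 1)
        (q ^ (2 * content (hookBox μ i))) (q ^ (2 * content (hookBox μ j)))).prod).prod

end HookFusion

/-! The factors satisfy a Yang–Baxter equation (`factor_braid`), so the fusion product is one case
of a product attached to words in distinct letters from `1, …, n`: `sortProd` sorts a word into
decreasing order and collects one factor for each pair `a < b` in which `a` stands before `b`. The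
word `1 2 … n` gives the fusion product. Swapping neighbours `a < b` of a word splits a factor off
on the left (`sortProd_swap`), so divisibility on the left means passing to another word whose
product is still regular at `(1, …, 1)`.

Poles come only from pairs `a < b` with equal contents. Such letters lie in different hooks, and
then `a + 1` is the neighbour of `a` in its hook. On the hook subspace the arguments of `a` and `a +
1` have constant ratio `q^{±2}`, so their factor is `T_i + q⁻¹` or `T_i - q`, a multiple of an
idempotent. If `a` and `a + 1` have occurred in this order before `b` is inserted, the product
collected so far ends in that factor, which cancels the pole (`eigen_mul_factor_mul_factor`,
`regular_mul_insertProd`). This proves existence; uniqueness follows on a line through `(1, …, 1)`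
that meets the domain infinitely often.

If `c_v < 0`, then `v = u + 1` lies in the same hook and the whole product starts with `T_u - q`.
Hence its value is killed by `T_u + q⁻¹`, and `q + q⁻¹ ≠ 0` turns this into divisibility.

If `c_v ≥ 0`, moving the letters `u, …, s` across `s + 1, …, v` splits off the required divisor,
whose factors have no poles. The difficulty is the remaining word: there `v` meets the left
neighbour of `u` before `u` has occurred, so the criterion fails when `v > s + 1`. One starts from a
word that does satisfy it, with the block of the lower hook ahead of the row letters of equal
contents, and exchanges these pairs `a`, `c` one by one. Each exchange is regular
(`regular_exchange`): the residue at `x_a = x_c` is a scalar, a product of terms `F(b, c) F(c, b)`,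
and one of these vanishes because a letter of adjacent content lies between. -/

namespace HookFusion

/-! ### Identities between factors in the Hecke algebra -/

section Relations

variable {K : Type*} [Field K] {q : K} {n : ℕ}

theorem T_eq {i : ℕ} (h : 1 ≤ i ∧ i < n) :
    T q n i = RingQuot.mkAlgHom K (HeckeRel q n) (FreeAlgebra.ι K ⟨i, h⟩) := dif_pos h

theorem T_quadratic {i : ℕ} (h1 : 1 ≤ i) (h2 : i < n) :
    (T q n i - algebraMap K (Hecke q n) q) * (T q n i + algebraMap K (Hecke q n) q⁻¹) = 0 := by
  have key := RingQuot.mkAlgHom_rel K (HeckeRel.quadratic (q := q) (n := n) ⟨i, h1, h2⟩)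
  rw [map_mul, map_sub, map_add, map_zero, AlgHom.commutes, AlgHom.commutes] at key
  rw [T_eq ⟨h1, h2⟩]
  exact key

theorem T_mul_self (hq : q ≠ 0) {i : ℕ} (h1 : 1 ≤ i) (h2 : i < n) :
    T q n i * T q n i = (q - q⁻¹) • T q n i + 1 := by
  have key := T_quadratic (q := q) h1 h2
  simp only [Algebra.algebraMap_eq_smul_one, sub_mul, mul_add, smul_mul_assoc, mul_smul_comm,
    one_mul, mul_one, smul_smul, smul_sub] at key
  rw [inv_mul_cancel₀ hq] at key
  linear_combination (norm := module) key

theorem T_braid {i : ℕ} (h1 : 1 ≤ i) (h2 : i + 1 < n) :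
    T q n i * T q n (i + 1) * T q n i = T q n (i + 1) * T q n i * T q n (i + 1) := by
  have hi : 1 ≤ i ∧ i < n := ⟨h1, by omega⟩
  have hj : 1 ≤ i + 1 ∧ i + 1 < n := ⟨by omega, h2⟩
  have key := RingQuot.mkAlgHom_rel K
    (HeckeRel.braid (q := q) (n := n) ⟨i, hi⟩ ⟨i + 1, hj⟩ rfl)
  simp only [map_mul] at key
  rw [T_eq hi, T_eq hj]
  exact key

theorem T_comm {i j : ℕ} (h : i + 1 < j) : Commute (T q n i) (T q n j) := by
  by_cases hi : 1 ≤ i ∧ i < n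
  · by_cases hj : 1 ≤ j ∧ j < n
    · have key := RingQuot.mkAlgHom_rel K
        (HeckeRel.comm (q := q) (n := n) ⟨i, hi⟩ ⟨j, hj⟩ h)
      simp only [map_mul] at key
      rw [T_eq hi, T_eq hj]
      exact key
    · simp [T, hj]
  · simp [T, hi]

theorem factor_comm {i j : ℕ} (h : i + 1 < j) (a b c d : K) :
    Commute (factor q n i a b) (factor q n j c d) := by
  unfold factor
  refine Commute.add_left (Commute.add_right (T_comm h) ?_) ?_
  · exact (Algebra.commutes _ _).symm
  · exact Algebra.commutes _ _

/-- This form isolates the pole `(b - a)⁻¹`; its coefficient is a scalar, which is what makes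
residues computable. -/
theorem factor_eq (i : ℕ) {a b : K} (ha : a ≠ 0) :
    factor q n i a b = T q n i + ((q - q⁻¹) * a * (b - a)⁻¹) • (1 : Hecke q n) := by
  unfold factor
  rw [Algebra.algebraMap_eq_smul_one]
  congr 2
  have : a⁻¹ * b - 1 = a⁻¹ * (b - a) := by field_simp
  rw [this, div_eq_mul_inv, mul_inv, inv_inv, mul_assoc]

/-- The Yang–Baxter equation with spectral parameters. With `A`, `B`, `C` the scalar parts for `(a,
b)`, `(a, c)`, `(b, c)`, the braid relation leaves a difference only in the coefficients of `T_i`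
and `T_{i+1}`, and it is a multiple of `A C - B (q - q⁻¹ + A + C) = 0`. -/
theorem factor_braid (hq : q ≠ 0) {i : ℕ} (h1 : 1 ≤ i) (h2 : i + 1 < n) {a b c : K}
    (ha : a ≠ 0) (hb : b ≠ 0) (hab : a ≠ b) (hac : a ≠ c) (hbc : b ≠ c) :
    factor q n i a b * factor q n (i + 1) a c * factor q n i b c =
      factor q n (i + 1) b c * factor q n i a c * factor q n (i + 1) a b := by
  rw [factor_eq i ha, factor_eq (i + 1) ha, factor_eq i hb, factor_eq (i + 1) hb,
    factor_eq i ha, factor_eq (i + 1) ha]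
  have h3 : b - a ≠ 0 := sub_ne_zero.2 hab.symm
  have h4 : c - a ≠ 0 := sub_ne_zero.2 hac.symm
  have h5 : c - b ≠ 0 := sub_ne_zero.2 hbc.symm
  have key : ((q - q⁻¹) * a * (b - a)⁻¹) * ((q - q⁻¹) * b * (c - b)⁻¹) =
      ((q - q⁻¹) * a * (c - a)⁻¹) * ((q - q⁻¹) + ((q - q⁻¹) * a * (b - a)⁻¹) +
        ((q - q⁻¹) * b * (c - b)⁻¹)) := by
    generalize q - q⁻¹ = e
    field_simp
    ring
  generalize ((q - q⁻¹) * a * (b - a)⁻¹) = A at *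
  generalize ((q - q⁻¹) * a * (c - a)⁻¹) = B at *
  generalize ((q - q⁻¹) * b * (c - b)⁻¹) = C at *
  have s1 := T_mul_self (n := n) hq h1 (by omega)
  have s2 := T_mul_self (n := n) hq (i := i + 1) (by omega) h2
  have s3 := T_braid (q := q) h1 h2
  generalize T q n i = s at *
  generalize T q n (i + 1) = t at *
  simp only [add_mul, mul_add, smul_mul_assoc, mul_smul_comm, one_mul, mul_one, smul_add,
    smul_smul, s1, s2, s3]
  have e1 : A * C = B * (q - q⁻¹) + B * A + B * C := by rw [key]; ring
  linear_combination (norm := module) e1 • t - e1 • s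

/-- The correction carries an explicit factor `c - a`, able to cancel a simple pole at `a = c`. -/
theorem factor_sub_factor (i : ℕ) {a b c : K} (ha : a ≠ 0) (hc : c ≠ 0) (hab : a ≠ b)
    (hcb : c ≠ b) :
    factor q n i a b = factor q n i c b +
      ((c - a) * (-((q - q⁻¹) * b * ((b - a)⁻¹ * (b - c)⁻¹)))) • (1 : Hecke q n) := by
  rw [factor_eq i ha, factor_eq i hc, add_assoc, ← add_smul]
  congr 2
  have h3 : b - a ≠ 0 := sub_ne_zero.2 hab.symm
  have h4 : b - c ≠ 0 := sub_ne_zero.2 hcb.symm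
  generalize q - q⁻¹ = e
  field_simp
  ring

/-- The scalar `F_i(b, c) F_i(c, b)`. -/
noncomputable def swapScalar (q b c : K) : K := 1 - (q - q⁻¹) ^ 2 * b * c * ((b - c) ^ 2)⁻¹

theorem factor_mul_swap (hq : q ≠ 0) {i : ℕ} (h1 : 1 ≤ i) (h2 : i < n) {b c : K}
    (hb : b ≠ 0) (hc : c ≠ 0) (hbc : b ≠ c) :
    factor q n i b c * factor q n i c b = swapScalar q b c • (1 : Hecke q n) := by
  rw [factor_eq i hb, factor_eq i hc]
  have s1 := T_mul_self (n := n) hq h1 h2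
  have h3 : b - c ≠ 0 := sub_ne_zero.2 hbc
  have h4 : c - b ≠ 0 := sub_ne_zero.2 hbc.symm
  have e1 : (q - q⁻¹) + (q - q⁻¹) * b * (c - b)⁻¹ + (q - q⁻¹) * c * (b - c)⁻¹ = 0 := by
    generalize q - q⁻¹ = e
    rw [← neg_sub b c, inv_neg]
    field_simp
    ring
  have e2 : 1 + (q - q⁻¹) * b * (c - b)⁻¹ * ((q - q⁻¹) * c * (b - c)⁻¹) = swapScalar q b c := by
    unfold swapScalar
    generalize q - q⁻¹ = e
    rw [← neg_sub b c, inv_neg]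
    field_simp
    ring
  rw [← e2]
  generalize ((q - q⁻¹) * b * (c - b)⁻¹) = B at *
  generalize ((q - q⁻¹) * c * (b - c)⁻¹) = C at *
  generalize T q n i = s at *
  simp only [add_mul, mul_add, smul_mul_assoc, mul_smul_comm, one_mul, mul_one, smul_add,
    smul_smul, s1]
  linear_combination (norm := module) e1 • s

theorem swapScalar_eq_zero (hq : q ≠ 0) {b c : K} (hbc : b ≠ c)
    (h : c = q ^ 2 * b) : swapScalar q b c = 0 := by
  have h3 : b - c ≠ 0 := sub_ne_zero.2 hbc
  have e : (b - c) ^ 2 = (q - q⁻¹) ^ 2 * b * c := by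
    rw [h]
    field_simp
    ring
  unfold swapScalar
  rw [← e, mul_inv_cancel₀ (pow_ne_zero 2 h3), sub_self]

theorem swapScalar_mul (b c : K) {z : K} (hz : z ≠ 0) :
    swapScalar q (b * z) (c * z) = swapScalar q b c := by
  unfold swapScalar
  by_cases h : b = c
  · simp [h]
  have h3 : b - c ≠ 0 := sub_ne_zero.2 h
  rw [← sub_mul]
  field_simp

/-- The two values of `β` for which `T_i + β` is proportional to an idempotent. -/
def IsEigen (q β : K) : Prop := β = q⁻¹ ∨ β = -q

theorem IsEigen.eq (hq : q ≠ 0) {β : K} (h : IsEigen q β) : (q - q⁻¹ + β) * β = 1 := by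
  rcases h with rfl | rfl <;> field_simp <;> ring

theorem factor_eq_of_eigen (hq : q ≠ 0) {β : K} (h : IsEigen q β) (i : ℕ) {a b : K}
    (ha : a ≠ 0) (hab : a ≠ b) (hb : a = β ^ 2 * b) :
    factor q n i a b = T q n i + β • (1 : Hecke q n) := by
  rw [factor_eq i ha]
  congr 2
  have h3 : b - a ≠ 0 := sub_ne_zero.2 hab.symm
  have e := h.eq hq
  generalize q - q⁻¹ = η at *
  rw [← div_eq_mul_inv, div_eq_iff h3, hb]
  linear_combination (β * b) * e

/-- A factor with a pole at `a = c` becomes regular between two factors with an argument `b`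
such that `F_i(a, b)` is proportional to an idempotent. -/
theorem eigen_mul_factor_mul_factor (hq : q ≠ 0) {β : K} (h : IsEigen q β) {i : ℕ} (h1 : 1 ≤ i)
    (h2 : i < n) {a b c : K} (ha : a ≠ 0) (hb : b ≠ 0) (hac : a ≠ c) (hbc : b ≠ c)
    (hab : a = β ^ 2 * b) :
    (T q n i + β • (1 : Hecke q n)) * factor q n (i + 1) a c * factor q n i b c =
      (T q n i + β • (1 : Hecke q n)) * (T q n (i + 1) * factor q n i b c +
        (β * ((q - q⁻¹) * b * (c - b)⁻¹)) • (1 : Hecke q n)) := by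
  rw [factor_eq i hb, factor_eq (i + 1) ha]
  have h4 : c - a ≠ 0 := sub_ne_zero.2 hac.symm
  have h5 : c - b ≠ 0 := sub_ne_zero.2 hbc.symm
  have s1 := T_mul_self (n := n) hq h1 h2
  have e := h.eq hq
  -- Since `(T_i + β) T_i = β⁻¹ (T_i + β)` with `β⁻¹ = q - q⁻¹ + β`, the pole `(c - a)⁻¹` is
  -- multiplied by this bracket, which vanishes at `c = a` because `a = β² b`.
  have key : ((q - q⁻¹) * a * (c - a)⁻¹) * (q - q⁻¹ + β + (q - q⁻¹) * b * (c - b)⁻¹) =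
      β * ((q - q⁻¹) * b * (c - b)⁻¹) := by
    generalize q - q⁻¹ = η at *
    field_simp
    rw [hab]
    linear_combination (η * β * b * c) * e
  generalize ((q - q⁻¹) * a * (c - a)⁻¹) = A at *
  generalize ((q - q⁻¹) * b * (c - b)⁻¹) = B at *
  generalize T q n i = s at *
  generalize T q n (i + 1) = t at *
  simp only [add_mul, mul_add, smul_mul_assoc, mul_smul_comm, one_mul, mul_one, smul_add,
    smul_smul, s1, mul_assoc]
  have key' : A + A * β * B = β * (β * B) := by linear_combination β * key - A * e
  linear_combination (norm := module) key • s + key' • (1 : Hecke q n)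

end Relations

/-! ### Products of factors attached to words -/

section Sorting

variable {K : Type*} [Field K] (q : K) (n : ℕ) (x : ℕ → K)

/-- The factors met when the letter `b`, standing to the right of the decreasing word whose
letters form the increasing list `D`, is moved to its place in that word. -/
noncomputable def insertProd : List ℕ → ℕ → Hecke q n
  | [], _ => 1
  | d :: D, b => if d < b then factor q n (D.length + 1) (x d) (x b) * insertProd D b else 1

/-- The factors met when the letters of a word are inserted one after the other into the
decreasing word whose letters form the increasing list `D`. -/
noncomputable def sortProd : List ℕ → List ℕ → Hecke q n
  | _, [] => 1
  | D, b :: L => insertProd q n x D b * sortProd (D.orderedInsert (· ≤ ·) b) L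

/-- The factors met when the letter `a` at position `o` moves right across the word `B`. -/
noncomputable def crossRight : ℕ → ℕ → List ℕ → Hecke q n
  | _, _, [] => 1
  | o, a, b :: B => factor q n o (x a) (x b) * crossRight (o + 1) a B

/-- The parameters of different letters `1, …, n` can be used in factors. -/
def Generic : Prop := ∀ a b, 1 ≤ a → a < b → b ≤ n → x a ≠ 0 ∧ x a ≠ x b

/-- Different letters from `1, …, n`. -/
def IsWord (L : List ℕ) : Prop := L.Nodup ∧ ∀ a ∈ L, 1 ≤ a ∧ a ≤ n

variable {q n x}

theorem IsWord.length_le {L : List ℕ} (h : IsWord n L) : L.length ≤ n := by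
  rw [← List.toFinset_card_of_nodup h.1]
  calc L.toFinset.card ≤ (Finset.Icc 1 n).card := Finset.card_le_card fun a ha => by
        simpa using h.2 a (List.mem_toFinset.1 ha)
    _ = n := by simp

theorem IsWord.perm {L M : List ℕ} (h : IsWord n L) (p : L.Perm M) : IsWord n M :=
  ⟨p.nodup_iff.1 h.1, fun a ha => h.2 a (p.mem_iff.2 ha)⟩

theorem IsWord.left {L M : List ℕ} (h : IsWord n (L ++ M)) : IsWord n L :=
  ⟨h.1.of_append_left, fun a ha => h.2 a (List.mem_append_left _ ha)⟩

theorem IsWord.cons {a : ℕ} {L : List ℕ} (h : IsWord n (a :: L)) : IsWord n L :=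
  ⟨h.1.of_cons, fun b hb => h.2 b (List.mem_cons_of_mem _ hb)⟩

theorem orderedInsert_perm (b : ℕ) (D : List ℕ) :
    (D.orderedInsert (· ≤ ·) b).Perm (b :: D) := List.perm_orderedInsert _ _ _

theorem orderedInsert_comm (a b : ℕ) (D : List ℕ) :
    (D.orderedInsert (· ≤ ·) a).orderedInsert (· ≤ ·) b =
      (D.orderedInsert (· ≤ ·) b).orderedInsert (· ≤ ·) a := by
  induction D with
  | nil => simp only [List.orderedInsert]; split_ifs <;> grind
  | cons d D ih => simp only [List.orderedInsert]; split_ifs <;> grind [List.orderedInsert]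

theorem orderedInsert_length (b : ℕ) (D : List ℕ) :
    (D.orderedInsert (· ≤ ·) b).length = D.length + 1 := by
  simpa using (orderedInsert_perm b D).length_eq

theorem factor_comm_insertProd (D : List ℕ) (b : ℕ) {j : ℕ} (hj : D.length + 1 < j) (c d : K) :
    Commute (factor q n j c d) (insertProd q n x D b) := by
  induction D with
  | nil => exact Commute.one_right _
  | cons e D ih =>
    simp only [List.length_cons] at hj
    unfold insertProd
    split_ifs
    · exact ((factor_comm (by omega) _ _ _ _).symm).mul_right (ih (by omega))
    · exact Commute.one_right _

/-- The letters `a` and `b` may cross before or after their insertion. Only a letter `d` below both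
matters: its crossings with `a` and `b` and the crossing of `a` with `b` form a Yang–Baxter triple.
-/
theorem insertProd_exchange (hq : q ≠ 0) (hx : Generic n x) {a b : ℕ} (hab : a < b) (D : List ℕ)
    (hD : IsWord n (a :: b :: D)) :
    insertProd q n x D a * insertProd q n x (D.orderedInsert (· ≤ ·) a) b =
      factor q n (D.length + 1) (x a) (x b) * insertProd q n x D b *
        insertProd q n x (D.orderedInsert (· ≤ ·) b) a := by
  induction D with
  | nil => simp [insertProd, hab, not_lt.2 hab.le]
  | cons d D ih =>
    have hlen := hD.length_le
    have hD' : IsWord n (a :: b :: D) := (hD.perm (M := d :: a :: b :: D) (by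
      exact (List.Perm.cons a (List.Perm.swap d b D)).trans (List.Perm.swap d a _))).cons
    simp only [List.length_cons] at hlen
    have ha := hD.2 a (by simp)
    have hb := hD.2 b (by simp)
    have hd := hD.2 d (by simp)
    have hne : a ≠ d ∧ b ≠ d := by
      have := hD.1
      simp only [List.nodup_cons, List.mem_cons, not_or] at this
      exact ⟨this.1.2.1, this.2.1.1⟩
    rcases lt_or_gt_of_ne hne.1 with h1 | h1
    · rcases lt_or_gt_of_ne hne.2 with h2 | h2
      · simp [insertProd, List.orderedInsert, h1.le, h2.le, hab, not_lt.2 h1.le, not_lt.2 h2.le,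
          not_lt.2 hab.le]
      · simp [insertProd, List.orderedInsert, h1.le, not_le.2 h2, hab, not_lt.2 h1.le, h2]
    · have h2 : d < b := h1.trans hab
      have c1 := factor_comm_insertProd (q := q) (n := n) (x := x) D a
        (j := D.length + 1 + 1) (by omega) (x d) (x b)
      have c2 := factor_comm_insertProd (q := q) (n := n) (x := x) D b
        (j := D.length + 1 + 1) (by omega) (x d) (x a)
      have br := factor_braid (n := n) hq (i := D.length + 1) (by omega) (by omega)
        (hx d a hd.1 h1 ha.2).1 (hx a b ha.1 hab hb.2).1 (hx d a hd.1 h1 ha.2).2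
        (hx d b hd.1 h2 hb.2).2 (hx a b ha.1 hab hb.2).2
      have ih := ih hD'
      simp only [insertProd, List.orderedInsert, not_le.2 h1, not_le.2 h2, if_false, h1, h2,
        if_true, orderedInsert_length, List.length_cons]
      calc _ = factor q n (D.length + 1) (x d) (x a) * (insertProd q n x D a *
            factor q n (D.length + 1 + 1) (x d) (x b)) *
              insertProd q n x (D.orderedInsert (· ≤ ·) a) b := by simp only [mul_assoc]
        _ = factor q n (D.length + 1) (x d) (x a) * factor q n (D.length + 1 + 1) (x d) (x b) *
              (insertProd q n x D a * insertProd q n x (D.orderedInsert (· ≤ ·) a) b) := by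
            rw [← c1.eq]; simp only [mul_assoc]
        _ = (factor q n (D.length + 1) (x d) (x a) * factor q n (D.length + 1 + 1) (x d) (x b) *
              factor q n (D.length + 1) (x a) (x b)) * insertProd q n x D b *
              insertProd q n x (D.orderedInsert (· ≤ ·) b) a := by
            rw [ih]; simp only [mul_assoc]
        _ = _ := by
            rw [br]
            simp only [mul_assoc]
            rw [← mul_assoc (factor q n (D.length + 1 + 1) (x d) (x a)), c2.eq]
            simp only [mul_assoc]

/-- The insertions of the letters of `L₁` only use indices at least two below that of the split
factor, so the latter commutes to the far left. -/
theorem sortProd_swap (hq : q ≠ 0) (hx : Generic n x) {a b : ℕ} (hab : a < b)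
    (L₁ L₂ D : List ℕ) (hD : IsWord n (D ++ (L₁ ++ a :: b :: L₂))) :
    sortProd q n x D (L₁ ++ a :: b :: L₂) =
      factor q n (D.length + L₁.length + 1) (x a) (x b) *
        sortProd q n x D (L₁ ++ b :: a :: L₂) := by
  induction L₁ generalizing D with
  | nil =>
    have hw : IsWord n (a :: b :: D) := by
      refine ((hD.perm (M := (a :: b :: D) ++ L₂) ?_)).left
      simp only [List.nil_append]
      exact List.perm_append_comm.trans (by simpa using List.perm_append_comm)
    have key := insertProd_exchange hq hx hab D hw
    have hsw : (D.orderedInsert (· ≤ ·) a).orderedInsert (· ≤ ·) b =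
        (D.orderedInsert (· ≤ ·) b).orderedInsert (· ≤ ·) a := orderedInsert_comm a b D
    simp only [List.nil_append, sortProd, List.length_nil, add_zero]
    rw [hsw, ← mul_assoc, key]
    simp only [mul_assoc]
  | cons c L₁ ih =>
    simp only [List.cons_append, sortProd]
    rw [ih _ (hD.perm ?_)]
    · rw [orderedInsert_length, ← mul_assoc, ← mul_assoc]
      have e : D.length + 1 + L₁.length + 1 = D.length + (c :: L₁).length + 1 := by
        simp only [List.length_cons]; omega
      rw [e, (factor_comm_insertProd D c (by simp only [List.length_cons]; omega) _ _).eq]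
    · exact (List.perm_middle).trans
        ((orderedInsert_perm c D).symm.append_right _)

theorem sortProd_crossRight (hq : q ≠ 0) (hx : Generic n x) {a : ℕ} (L₁ L₂ D : List ℕ)
    (B : List ℕ) (hB : ∀ b ∈ B, a < b) (hD : IsWord n (D ++ (L₁ ++ a :: B ++ L₂))) :
    sortProd q n x D (L₁ ++ a :: B ++ L₂) =
      crossRight q n x (D.length + L₁.length + 1) a B *
        sortProd q n x D (L₁ ++ B ++ a :: L₂) := by
  induction B generalizing L₁ with
  | nil => simp [crossRight]
  | cons b B ih =>
    have e1 : L₁ ++ a :: b :: B ++ L₂ = L₁ ++ a :: b :: (B ++ L₂) := by simp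
    have e2 : L₁ ++ b :: a :: (B ++ L₂) = (L₁ ++ [b]) ++ a :: B ++ L₂ := by simp
    have e3 : (L₁ ++ [b]) ++ B ++ a :: L₂ = L₁ ++ b :: B ++ a :: L₂ := by simp
    rw [e1] at hD ⊢
    rw [sortProd_swap hq hx (hB b (by simp)) L₁ (B ++ L₂) D hD, e2,
      ih (L₁ ++ [b]) (fun c hc => hB c (by simp [hc])) ?_, e3, crossRight, mul_assoc]
    · simp [add_assoc]
    · rw [← e2]
      exact hD.perm (((List.Perm.swap b a _).append_left _).append_left _)

theorem sortProd_append (D L M : List ℕ) :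
    sortProd q n x D (L ++ M) = sortProd q n x D L *
      sortProd q n x (L.foldl (fun D b => D.orderedInsert (· ≤ ·) b) D) M := by
  induction L generalizing D with
  | nil => simp [sortProd]
  | cons b L ih => simp [sortProd, ih, mul_assoc]

/-- The letters of a word in increasing order. -/
def sortedLetters (L : List ℕ) : List ℕ :=
  L.foldl (fun D b => D.orderedInsert (· ≤ ·) b) []

theorem sortedLetters_concat (L : List ℕ) (b : ℕ) :
    sortedLetters (L ++ [b]) = (sortedLetters L).orderedInsert (· ≤ ·) b := by
  simp [sortedLetters]

theorem sortedLetters_perm (L : List ℕ) : (sortedLetters L).Perm L := by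
  induction L using List.reverseRecOn with
  | nil => simp [sortedLetters]
  | append_singleton L b ih =>
    rw [sortedLetters_concat]
    exact (orderedInsert_perm b _).trans ((ih.cons b).trans (List.perm_append_singleton b L).symm)

theorem sortedLetters_pairwise {L : List ℕ} (h : L.Nodup) :
    (sortedLetters L).Pairwise (· < ·) := by
  have h1 : (sortedLetters L).Pairwise (· ≤ ·) := by
    clear h
    induction L using List.reverseRecOn with
    | nil => simp [sortedLetters]
    | append_singleton L b ih =>
      rw [sortedLetters_concat]
      exact ih.orderedInsert b _
  have h2 : (sortedLetters L).Nodup := (sortedLetters_perm L).nodup_iff.2 h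
  exact h1.imp₂ (fun a b h h' => lt_of_le_of_ne h h') h2

theorem sortProd_concat (L : List ℕ) (b : ℕ) :
    sortProd q n x [] (L ++ [b]) =
      sortProd q n x [] L * insertProd q n x (sortedLetters L) b := by
  rw [sortProd_append]
  simp [sortProd, sortedLetters]

/-- No letter lies between `a` and `a + 1`, so `b` passes both, by Yang–Baxter, or neither. Thus the
factor of the pair survives at the right end, at the current place of the pair. -/
theorem factor_mul_insertProd (hq : q ≠ 0) (hx : Generic n x) {a b : ℕ} (D₁ D₂ : List ℕ)
    (hD : IsWord n (b :: (D₁ ++ a :: (a + 1) :: D₂))) :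
    ∃ W D₁' D₂', (D₁ ++ a :: (a + 1) :: D₂).orderedInsert (· ≤ ·) b =
        D₁' ++ a :: (a + 1) :: D₂' ∧
      factor q n (D₂.length + 1) (x a) (x (a + 1)) *
          insertProd q n x (D₁ ++ a :: (a + 1) :: D₂) b =
        W * factor q n (D₂'.length + 1) (x a) (x (a + 1)) := by
  have hb := hD.2 b (by simp)
  have ha := hD.2 a (by simp)
  have ha' := hD.2 (a + 1) (by simp)
  have hlen := hD.length_le
  induction D₁ with
  | nil =>
    have hne : b ≠ a ∧ b ≠ a + 1 := by
      have := hD.1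
      simp only [List.nil_append, List.nodup_cons, List.mem_cons, not_or] at this
      exact ⟨this.1.1, this.1.2.1⟩
    simp only [List.nil_append, List.length_cons] at hlen
    rcases lt_or_gt_of_ne hne.1 with h | h
    · refine ⟨1, [b], D₂, ?_, ?_⟩
      · simp [h.le]
      · simp [insertProd, not_lt.2 h.le]
    · have h2 : a + 1 < b := by omega
      refine ⟨factor q n (D₂.length + 1 + 1) (x (a + 1)) (x b) *
        factor q n (D₂.length + 1) (x a) (x b) * insertProd q n x D₂ b, [],
        D₂.orderedInsert (· ≤ ·) b, ?_, ?_⟩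
      · simp [List.orderedInsert, not_le.2 h, not_le.2 h2]
      · have br := factor_braid (n := n) hq (i := D₂.length + 1) (by omega) (by omega)
          (hx a b ha.1 h hb.2).1 (hx (a + 1) b ha'.1 h2 hb.2).1
          (hx a (a + 1) ha.1 (by omega) ha'.2).2
          (hx a b ha.1 h hb.2).2 (hx (a + 1) b ha'.1 h2 hb.2).2
        have c1 := factor_comm_insertProd (q := q) (n := n) (x := x) D₂ b
          (j := D₂.length + 1 + 1) (by omega) (x a) (x (a + 1))
        simp only [List.nil_append, insertProd, h, h2, if_true, List.length_cons,
          orderedInsert_length]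
        rw [← mul_assoc, ← mul_assoc, br, mul_assoc _ (insertProd q n x D₂ b), ← c1.eq]
        simp only [mul_assoc]
  | cons d D₁ ih =>
    by_cases h : b ≤ d
    · refine ⟨1, b :: d :: D₁, D₂, ?_, ?_⟩
      · simp [h]
      · simp [insertProd, not_lt.2 h]
    · obtain ⟨W, D₁', D₂', h1, h2⟩ := ih (hD.perm (List.Perm.swap d b _)).cons (by
        simp only [List.cons_append, List.length_cons] at hlen ⊢; omega)
      refine ⟨factor q n ((D₁ ++ a :: (a + 1) :: D₂).length + 1) (x d) (x b) * W,
        d :: D₁', D₂', ?_, ?_⟩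
      · simp [h, h1]
      · simp only [List.cons_append, insertProd, not_le.1 h, if_true]
        rw [← mul_assoc, (factor_comm (by simp only [List.length_append, List.length_cons]; omega)
          _ _ _ _).eq, mul_assoc, h2, mul_assoc]

/-- On its way `a + 1` meets the smaller letters in increasing order, hence `a` last. -/
theorem insertProd_succ {a : ℕ} (D : List ℕ) (hD : D.Pairwise (· < ·)) (ha : a ∈ D)
    (ha' : a + 1 ∉ D) :
    ∃ W D₁ D₂, D.orderedInsert (· ≤ ·) (a + 1) = D₁ ++ a :: (a + 1) :: D₂ ∧
      insertProd q n x D (a + 1) = W * factor q n (D₂.length + 1) (x a) (x (a + 1)) := by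
  induction D with
  | nil => simp at ha
  | cons d D ih =>
    have hlt := (List.pairwise_cons.1 hD).1
    simp only [List.mem_cons, not_or] at ha ha'
    by_cases hd : d = a
    · subst hd
      refine ⟨1, [], D, ?_, ?_⟩
      · cases D with
        | nil => simp [List.orderedInsert]
        | cons e D => have := hlt e (by simp); simp [List.orderedInsert, Nat.succ_le_of_lt this]
      · cases D with
        | nil => simp [insertProd]
        | cons e D =>
          have := hlt e (by simp)
          have h2 : ¬ e < d + 1 := by omega
          simp [insertProd, h2]
    · have ha2 : a ∈ D := ha.resolve_left fun h => hd h.symm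
      obtain ⟨W, D₁, D₂, h1, h2⟩ := ih hD.of_cons ha2 ha'.2
      have hda : d < a + 1 := (hlt a ha2).trans (Nat.lt_succ_self a)
      refine ⟨factor q n (D.length + 1) (x d) (x (a + 1)) * W, d :: D₁, D₂, ?_, ?_⟩
      · simp [List.orderedInsert, not_le.2 hda, h1]
      · simp [insertProd, hda, h2, mul_assoc]

theorem pair_sublist_concat {a a' b : ℕ} {L : List ℕ} (h : [a, a'].Sublist (L ++ [b])) :
    [a, a'].Sublist L ∨ (a ∈ L ∧ a' = b) := by
  have h := List.reverse_sublist.2 h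
  simp only [List.reverse_append, List.reverse_cons, List.reverse_nil, List.nil_append,
    List.cons_append] at h
  cases h with
  | cons _ h => exact Or.inl (by simpa using List.reverse_sublist.2 h)
  | cons_cons _ h => exact Or.inr ⟨by simpa using h, rfl⟩

/-- The source of the idempotents: the pair contributes its factor when `a + 1` is inserted, and
later insertions keep it at the right end. Its index is the number of letters greater than `a`. -/
theorem sortProd_eq_mul_factor (hq : q ≠ 0) (hx : Generic n x) {a : ℕ} {L : List ℕ}
    (hL : IsWord n L) (ha : [a, a + 1].Sublist L) :
    ∃ W D₁ D₂, sortedLetters L = D₁ ++ a :: (a + 1) :: D₂ ∧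
      sortProd q n x [] L = W * factor q n (D₂.length + 1) (x a) (x (a + 1)) := by
  induction L using List.reverseRecOn with
  | nil => simp at ha
  | append_singleton L b ih =>
    rw [sortedLetters_concat, sortProd_concat]
    rcases pair_sublist_concat ha with h | ⟨h, rfl⟩
    · obtain ⟨W, D₁, D₂, h1, h2⟩ := ih hL.left h
      obtain ⟨W', D₁', D₂', h3, h4⟩ := factor_mul_insertProd hq hx (b := b) D₁ D₂ (by
        rw [← h1]
        exact hL.perm ((List.perm_append_singleton b L).trans
          ((sortedLetters_perm L).symm.cons b)))
      refine ⟨W * W', D₁', D₂', by rw [h1, h3], ?_⟩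
      rw [h2, h1, mul_assoc, h4, mul_assoc]
    · have hnd := (List.perm_append_singleton (a + 1) L).nodup_iff.1 hL.1
      obtain ⟨W', D₁', D₂', h3, h4⟩ := insertProd_succ (q := q) (n := n) (x := x) (a := a)
        (sortedLetters L) (sortedLetters_pairwise hnd.of_cons)
        ((sortedLetters_perm L).mem_iff.2 h)
        (fun h' => (List.nodup_cons.1 hnd).1 ((sortedLetters_perm L).mem_iff.1 h'))
      exact ⟨_, D₁', D₂', h3, by rw [h4, mul_assoc]⟩

theorem insertProd_range' (m k j : ℕ) (h : m + k ≤ j) :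
    insertProd q n x (List.range' m k) j =
      ((List.range' m k).map fun i => factor q n (m + k - i) (x i) (x j)).prod := by
  induction k generalizing m with
  | zero => simp [insertProd]
  | succ k ih =>
    rw [List.range'_succ, insertProd, if_pos (by omega), ih (m + 1) (by omega), List.map_cons,
      List.prod_cons, List.length_range']
    have e : m + (k + 1) - m = k + 1 := by omega
    have e' : m + 1 + k = m + (k + 1) := by omega
    rw [e, e']

theorem sortedLetters_range' (k : ℕ) : sortedLetters (List.range' 1 k) = List.range' 1 k := by
  have h : (List.range' 1 k).Nodup := List.nodup_range'
  exact (sortedLetters_perm _).eq_of_pairwise' (sortedLetters_pairwise h)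
    List.pairwise_lt_range'

theorem sortProd_range' (k : ℕ) :
    sortProd q n x [] (List.range' 1 k) =
      ((List.range' 1 k).map fun j =>
        ((List.range' 1 (j - 1)).map fun i => factor q n (j - i) (x i) (x j)).prod).prod := by
  induction k with
  | zero => simp [sortProd]
  | succ k ih =>
    rw [List.range'_1_concat, sortProd_concat, ih, sortedLetters_range',
      insertProd_range' 1 k (1 + k) le_rfl]
    simp

theorem crossRight_range' (o a m k : ℕ) :
    crossRight q n x o a (List.range' m k) =
      ((List.range' m k).map fun j => factor q n (o + j - m) (x a) (x j)).prod := by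
  induction k generalizing o m with
  | zero => simp [crossRight]
  | succ k ih =>
    rw [List.range'_succ, crossRight, ih, List.map_cons, List.prod_cons]
    congr 2
    · omega
    · refine List.map_congr_left fun j hj => ?_
      have := List.mem_range'_1.1 hj
      rw [show o + 1 + j - (m + 1) = o + j - m by omega]

/-- Moving the letters `u, …, u + k - 1` one after the other, the last one first, across a block
of larger letters. -/
theorem sortProd_crossBlock (hq : q ≠ 0) (hx : Generic n x) (L₁ L₂ : List ℕ) (u k : ℕ)
    (B : List ℕ) (hB : ∀ b ∈ B, u + k ≤ b)
    (hL : IsWord n (L₁ ++ List.range' u k ++ B ++ L₂)) :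
    sortProd q n x [] (L₁ ++ List.range' u k ++ B ++ L₂) =
      ((List.range' u k).reverse.map fun i =>
        crossRight q n x (L₁.length + i + 1 - u) i B).prod *
      sortProd q n x [] (L₁ ++ B ++ List.range' u k ++ L₂) := by
  induction k generalizing L₂ with
  | zero => simp
  | succ k ih =>
    have e : L₁ ++ List.range' u (k + 1) ++ B ++ L₂ =
        (L₁ ++ List.range' u k) ++ (u + k) :: B ++ L₂ := by
      simp [List.range'_1_concat]
    have e2 : (L₁ ++ List.range' u k) ++ B ++ (u + k) :: L₂ =
        L₁ ++ List.range' u k ++ B ++ ((u + k) :: L₂) := by simp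
    have e3 : L₁ ++ B ++ List.range' u k ++ ((u + k) :: L₂) =
        L₁ ++ B ++ List.range' u (k + 1) ++ L₂ := by
      simp [List.range'_1_concat]
    rw [e] at hL ⊢
    have hL' : IsWord n (L₁ ++ List.range' u k ++ B ++ ((u + k) :: L₂)) := by
      refine hL.perm ?_
      simp only [List.append_assoc, List.cons_append]
      exact (List.perm_middle.symm.append_left _).append_left _
    rw [sortProd_crossRight hq hx _ _ [] B (fun b hb => by have := hB b hb; omega) (by simpa using hL),
      e2, ih _ (fun b hb => by have := hB b hb; omega) hL', e3, List.range'_1_concat,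
      List.reverse_append, List.map_append, List.prod_append, mul_assoc]
    simp only [List.reverse_singleton, List.map_cons, List.map_nil, List.prod_cons, List.prod_nil,
      mul_one, List.length_nil, List.length_append, List.length_range', zero_add]
    rw [show L₁.length + k + 1 = L₁.length + (u + k) + 1 - u by omega]

end Sorting

/-! ### Calculus of regular values -/

section Regular

variable {K ι A A' A'' : Type*} [Field K] [AddCommGroup A] [Module K A] [AddCommGroup A']
  [Module K A'] [AddCommGroup A''] [Module K A''] {U : Set (ι → K)} {p : ι → K}

theorem HasRegularValue.of_fintype {f : (ι → K) → A} {v : A} {σ : Type*} [Fintype σ]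
    (P : σ → MvPolynomial ι K) (a : σ → A) (D : MvPolynomial ι K)
    (hD : MvPolynomial.eval p D ≠ 0)
    (hf : ∀ z ∈ U, MvPolynomial.eval z D • f z = ∑ k, MvPolynomial.eval z (P k) • a k)
    (hv : MvPolynomial.eval p D • v = ∑ k, MvPolynomial.eval p (P k) • a k) :
    HasRegularValue U f p v := by
  let e := (Fintype.equivFin σ).symm
  refine ⟨Fintype.card σ, P ∘ e, a ∘ e, D, hD, fun z hz => ?_, ?_⟩
  · rw [hf z hz]; exact (Equiv.sum_comp e _).symm
  · rw [hv]; exact (Equiv.sum_comp e _).symm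

theorem HasRegularValue.congr {f g : (ι → K) → A} {v : A} (h : HasRegularValue U f p v)
    (hfg : ∀ z ∈ U, g z = f z) : HasRegularValue U g p v := by
  obtain ⟨m, P, a, D, h1, h2, h3⟩ := h
  exact ⟨m, P, a, D, h1, fun z hz => by rw [hfg z hz, h2 z hz], h3⟩

theorem HasRegularValue.const (v : A) : HasRegularValue U (fun _ => v) p v :=
  HasRegularValue.of_fintype (σ := Unit) (fun _ => 1) (fun _ => v) 1 (by simp) (by simp) (by simp)

theorem HasRegularValue.map₂ (B : A →ₗ[K] A' →ₗ[K] A'') {f : (ι → K) → A} {g : (ι → K) → A'}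
    {v : A} {w : A'} (hf : HasRegularValue U f p v) (hg : HasRegularValue U g p w) :
    HasRegularValue U (fun z => B (f z) (g z)) p (B v w) := by
  obtain ⟨m, P, a, D, h1, h2, h3⟩ := hf
  obtain ⟨m', P', a', D', h1', h2', h3'⟩ := hg
  have key : ∀ (z : ι → K) (x : A) (y : A'),
      MvPolynomial.eval z D • x = ∑ k, MvPolynomial.eval z (P k) • a k →
      MvPolynomial.eval z D' • y = ∑ k, MvPolynomial.eval z (P' k) • a' k →
      MvPolynomial.eval z (D * D') • B x y =
        ∑ k : Fin m × Fin m', MvPolynomial.eval z (P k.1 * P' k.2) • B (a k.1) (a' k.2) := by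
    intro z x y hx hy
    calc MvPolynomial.eval z (D * D') • B x y
        = B (MvPolynomial.eval z D • x) (MvPolynomial.eval z D' • y) := by
          simp [smul_smul, mul_comm]
      _ = _ := by
          rw [hx, hy]
          simp [Fintype.sum_prod_type, smul_smul, Finset.smul_sum]
          exact Finset.sum_comm.trans (by simp only [mul_comm])
  exact HasRegularValue.of_fintype _ _ (D * D') (by simp [h1, h1'])
    (fun z hz => key z _ _ (h2 z hz) (h2' z hz)) (key p _ _ h3 h3')

theorem HasRegularValue.add {f g : (ι → K) → A} {v w : A} (hf : HasRegularValue U f p v)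
    (hg : HasRegularValue U g p w) : HasRegularValue U (fun z => f z + g z) p (v + w) := by
  obtain ⟨m, P, a, D, h1, h2, h3⟩ := hf
  obtain ⟨m', P', a', D', h1', h2', h3'⟩ := hg
  have key : ∀ (z : ι → K) (x y : A),
      MvPolynomial.eval z D • x = ∑ k, MvPolynomial.eval z (P k) • a k →
      MvPolynomial.eval z D' • y = ∑ k, MvPolynomial.eval z (P' k) • a' k →
      MvPolynomial.eval z (D * D') • (x + y) =
        ∑ k : Fin m ⊕ Fin m', MvPolynomial.eval z
          (Sum.elim (fun k => D' * P k) (fun k => D * P' k) k) • Sum.elim a a' k := by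
    intro z x y hx hy
    calc MvPolynomial.eval z (D * D') • (x + y)
        = MvPolynomial.eval z D' • (MvPolynomial.eval z D • x) +
            MvPolynomial.eval z D • (MvPolynomial.eval z D' • y) := by
          rw [smul_smul, smul_smul, map_mul, smul_add, mul_comm (MvPolynomial.eval z D')]
      _ = _ := by
          rw [hx, hy]
          simp [smul_smul, Finset.smul_sum]
  exact HasRegularValue.of_fintype _ _ (D * D') (by simp [h1, h1'])
    (fun z hz => key z _ _ (h2 z hz) (h2' z hz)) (key p _ _ h3 h3')

theorem HasRegularValue.eval (g : MvPolynomial ι K) :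
    HasRegularValue U (fun z => MvPolynomial.eval z g) p (MvPolynomial.eval p g) :=
  HasRegularValue.of_fintype (σ := Unit) (fun _ => g) (fun _ => 1) 1 (by simp) (by simp) (by simp)

theorem HasRegularValue.inv_eval (g : MvPolynomial ι K) (hp : MvPolynomial.eval p g ≠ 0)
    (hg : ∀ z ∈ U, MvPolynomial.eval z g ≠ 0) :
    HasRegularValue U (fun z => (MvPolynomial.eval z g)⁻¹) p (MvPolynomial.eval p g)⁻¹ :=
  HasRegularValue.of_fintype (σ := Unit) (fun _ => 1) (fun _ => 1) g hp
    (fun z hz => by simp [hg z hz]) (by simp [hp])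

theorem HasRegularValue.smul {r : (ι → K) → K} {f : (ι → K) → A} {c : K} {v : A}
    (hr : HasRegularValue U r p c) (hf : HasRegularValue U f p v) :
    HasRegularValue U (fun z => r z • f z) p (c • v) :=
  hr.map₂ (LinearMap.lsmul K A) hf

theorem HasRegularValue.mul {R : Type*} [Ring R] [Algebra K R] {f g : (ι → K) → R} {v w : R}
    (hf : HasRegularValue U f p v) (hg : HasRegularValue U g p w) :
    HasRegularValue U (fun z => f z * g z) p (v * w) :=
  hf.map₂ (LinearMap.mul K R) hg

theorem HasRegularValue.list_prod {R β : Type*} [Ring R] [Algebra K R] {f : β → (ι → K) → R}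
    {v : β → R} (L : List β) (h : ∀ b ∈ L, HasRegularValue U (f b) p (v b)) :
    HasRegularValue U (fun z => (L.map fun b => f b z).prod) p (L.map v).prod := by
  induction L with
  | nil => simpa using HasRegularValue.const (1 : R)
  | cons b L ih =>
    simpa using (h b (by simp)).mul (ih fun c hc => h c (by simp [hc]))

/-- The value of a function at a point is unique if a line through the point meets the domain in
infinitely many points. -/
theorem HasRegularValue.unique {f : (ι → K) → A} {v w : A} (hf : HasRegularValue U f p v)
    (hg : HasRegularValue U f p w) (d : ι → K) (hd : {e : K | p + e • d ∈ U}.Infinite) :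
    v = w := by
  obtain ⟨m, P, a, D, h1, h2, h3⟩ := hf
  obtain ⟨m', P', a', D', h1', h2', h3'⟩ := hg
  rw [← sub_eq_zero]
  refine (Module.forall_dual_apply_eq_zero_iff K (v - w)).1 fun φ => ?_
  let line : ι → Polynomial K := fun i => Polynomial.C (p i) + Polynomial.X * Polynomial.C (d i)
  let R : MvPolynomial ι K → Polynomial K := fun g => MvPolynomial.aeval line g
  have hR : ∀ (e : K) (g : MvPolynomial ι K), (R g).eval e = MvPolynomial.eval (p + e • d) g := by
    intro e g
    have : (Polynomial.evalRingHom e).comp (MvPolynomial.aeval (R := K) line : _ →ₐ[K] _).toRingHom =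
        MvPolynomial.eval (p + e • d) := by
      ext i
      · simp
      · simpa [line] using mul_comm _ _
    exact congrArg (fun F : MvPolynomial ι K →+* K => F g) this
  -- The difference of the two fractions along the line, with denominators cleared and a functional
  -- `φ` applied. It vanishes at infinitely many parameters, hence also at `0`, where both
  -- denominators are nonzero.
  let Q : Polynomial K := R D' * ∑ k, R (P k) * Polynomial.C (φ (a k)) -
    R D * ∑ k, R (P' k) * Polynomial.C (φ (a' k))
  have hQ : ∀ e : K, Q.eval e =
      MvPolynomial.eval (p + e • d) D' * φ (∑ k, MvPolynomial.eval (p + e • d) (P k) • a k) -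
      MvPolynomial.eval (p + e • d) D * φ (∑ k, MvPolynomial.eval (p + e • d) (P' k) • a' k) := by
    intro e
    simp only [Q, Polynomial.eval_sub, Polynomial.eval_mul, Polynomial.eval_finsetSum, hR,
      Polynomial.eval_C, map_sum, map_smul, smul_eq_mul]
  have hQ0 : Q = 0 := by
    refine Polynomial.eq_zero_of_infinite_isRoot Q (hd.mono fun e he => ?_)
    change Q.eval e = 0
    rw [hQ, ← h2 _ he, ← h2' _ he, map_smul, map_smul, smul_eq_mul, smul_eq_mul]
    ring
  have := hQ 0
  rw [hQ0, zero_smul, add_zero, ← h3, ← h3'] at this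
  simp only [Polynomial.eval_zero, map_smul, smul_eq_mul] at this
  have h4 : MvPolynomial.eval p D * MvPolynomial.eval p D' * (φ v - φ w) = 0 := by
    linear_combination -this
  rw [map_sub]
  exact (mul_eq_zero.1 h4).resolve_left (mul_ne_zero h1 h1')

/-- Regularity is preserved under a rescaling that preserves the domain and the function. -/
theorem HasRegularValue.scale {f : (ι → K) → A} {v : A} (hf : HasRegularValue U f p v) {t : K}
    (ht : t ≠ 0) (hU : ∀ z ∈ U, t⁻¹ • z ∈ U) (hfs : ∀ z ∈ U, f (t⁻¹ • z) = f z) :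
    HasRegularValue U f (t • p) v := by
  obtain ⟨m, P, a, D, h1, h2, h3⟩ := hf
  let R : MvPolynomial ι K → MvPolynomial ι K :=
    fun g => MvPolynomial.aeval (fun i => MvPolynomial.C t⁻¹ * MvPolynomial.X i) g
  have hR : ∀ (z : ι → K) (g : MvPolynomial ι K),
      MvPolynomial.eval z (R g) = MvPolynomial.eval (t⁻¹ • z) g := by
    intro z g
    have : (MvPolynomial.eval z).comp (MvPolynomial.aeval (R := K)
        (fun i => MvPolynomial.C t⁻¹ * MvPolynomial.X i) : _ →ₐ[K] MvPolynomial ι K).toRingHom =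
        MvPolynomial.eval (t⁻¹ • z) := by
      ext <;> simp
    exact congrArg (fun F : MvPolynomial ι K →+* K => F g) this
  have e : t⁻¹ • t • p = p := by rw [smul_smul, inv_mul_cancel₀ ht, one_smul]
  refine ⟨m, fun k => R (P k), a, R D, ?_, fun z hz => ?_, ?_⟩
  · rwa [hR, e]
  · simp only [hR]
    rw [← h2 _ (hU z hz), hfs z hz]
  · simp only [hR, e]
    exact h3

/-- A function is regular at the point `p`. -/
def Regular (U : Set (ι → K)) (p : ι → K) (f : (ι → K) → A) : Prop := ∃ v, HasRegularValue U f p v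

theorem Regular.congr {f g : (ι → K) → A} (h : Regular U p f) (hfg : ∀ z ∈ U, g z = f z) :
    Regular U p g := h.imp fun _ h => h.congr hfg

theorem Regular.const (v : A) : Regular U p (fun _ => v) := ⟨v, .const v⟩

theorem Regular.add {f g : (ι → K) → A} (hf : Regular U p f) (hg : Regular U p g) :
    Regular U p (fun z => f z + g z) := ⟨_, hf.choose_spec.add hg.choose_spec⟩

theorem Regular.smul {r : (ι → K) → K} {f : (ι → K) → A} (hr : Regular U p r)
    (hf : Regular U p f) : Regular U p (fun z => r z • f z) :=
  ⟨_, hr.choose_spec.smul hf.choose_spec⟩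

theorem Regular.mul {R : Type*} [Ring R] [Algebra K R] {f g : (ι → K) → R}
    (hf : Regular U p f) (hg : Regular U p g) : Regular U p (fun z => f z * g z) :=
  ⟨_, hf.choose_spec.mul hg.choose_spec⟩

end Regular

/-! ### Poles and their cancellation on the hook subspace -/

section Tableau

variable {K : Type*} [Field K] {q : K} {n : ℕ} {box : ℕ → ℕ × ℕ}

theorem coord_of_le {z : Fin n → K} {a : ℕ} (h1 : 1 ≤ a) (h2 : a ≤ n) :
    coord z a = z ⟨a - 1, by omega⟩ := dif_pos _

theorem arg_ne {z : Fin n → K} (hz : z ∈ regularDomain q n box) {a b : ℕ} (ha : 1 ≤ a)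
    (ha' : a ≤ n) (hb : 1 ≤ b) (hb' : b ≤ n) (hab : a ≠ b) :
    arg q box z a ≠ arg q box z b := by
  rcases lt_or_gt_of_ne hab with h | h
  · exact (hz.2 a b ha h hb').2
  · exact (hz.2 b a hb h ha').2.symm

theorem generic_arg {z : Fin n → K} (hz : z ∈ regularDomain q n box) :
    Generic n (arg q box z) := fun a b ha hab hb => hz.2 a b ha hab hb

theorem arg_one {a : ℕ} (h1 : 1 ≤ a) (h2 : a ≤ n) :
    arg q box (fun _ : Fin n => (1 : K)) a = q ^ (2 * content (box a)) := by
  rw [arg, coord_of_le h1 h2, mul_one]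

/-- The polynomial function `z ↦ q^{2 c_a} z_a`. -/
noncomputable def argPoly (q : K) (n : ℕ) (box : ℕ → ℕ × ℕ) (a : ℕ) : MvPolynomial (Fin n) K :=
  MvPolynomial.C (q ^ (2 * content (box a))) *
    if h : a - 1 < n then MvPolynomial.X ⟨a - 1, h⟩ else 0

theorem eval_argPoly (z : Fin n → K) (a : ℕ) :
    MvPolynomial.eval z (argPoly q n box a) = arg q box z a := by
  unfold argPoly arg coord
  split_ifs <;> simp

theorem zpow_two_mul_ne (hq : q ≠ 0) (hroot : ∀ k : ℤ, k ≠ 0 → q ^ k ≠ 1) {c d : ℤ}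
    (h : c ≠ d) : q ^ (2 * c) ≠ q ^ (2 * d) := by
  intro e
  refine hroot (2 * c - 2 * d) (by omega) ?_
  rw [zpow_sub₀ hq, e, div_self (zpow_ne_zero _ hq)]

theorem regular_arg (a : ℕ) :
    Regular (regularDomain q n box) (fun _ => 1) (fun z => arg q box z a) :=
  Regular.congr (f := fun z => MvPolynomial.eval z (argPoly q n box a)) ⟨_, .eval _⟩ fun z _ => (eval_argPoly z a).symm

theorem hasRegularValue_inv_sub (hq : q ≠ 0) (hroot : ∀ k : ℤ, k ≠ 0 → q ^ k ≠ 1) {a b : ℕ}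
    (ha : 1 ≤ a) (ha' : a ≤ n) (hb : 1 ≤ b) (hb' : b ≤ n)
    (hab : content (box a) ≠ content (box b)) :
    HasRegularValue (regularDomain q n box) (fun z => (arg q box z b - arg q box z a)⁻¹)
      (fun _ => 1) (q ^ (2 * content (box b)) - q ^ (2 * content (box a)))⁻¹ := by
  have h := HasRegularValue.inv_eval (U := regularDomain q n box) (p := fun _ => 1)
    (argPoly q n box b - argPoly q n box a)
  simp only [map_sub, eval_argPoly, arg_one ha ha', arg_one hb hb'] at h
  exact h (sub_ne_zero.2 (zpow_two_mul_ne hq hroot hab.symm))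
    fun z hz => sub_ne_zero.2 (arg_ne hz hb hb' ha ha' (by rintro rfl; exact hab rfl))

theorem hasRegularValue_factor (hq : q ≠ 0) (hroot : ∀ k : ℤ, k ≠ 0 → q ^ k ≠ 1) {a b : ℕ}
    (i : ℕ) (ha : 1 ≤ a) (hlt : a < b) (hb' : b ≤ n)
    (hab : content (box a) ≠ content (box b)) :
    HasRegularValue (regularDomain q n box)
      (fun z => factor q n i (arg q box z a) (arg q box z b)) (fun _ => 1)
      (factor q n i (q ^ (2 * content (box a))) (q ^ (2 * content (box b)))) := by
  rw [factor_eq i (zpow_ne_zero _ hq)]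
  have h1 : HasRegularValue (regularDomain q n box) (fun z => arg q box z a) (fun _ => 1)
      (q ^ (2 * content (box a))) := by
    have := HasRegularValue.eval (U := regularDomain q n box) (p := fun _ => 1) (argPoly q n box a)
    simpa only [eval_argPoly, arg_one ha (by omega : a ≤ n)] using this
  have h2 := hasRegularValue_inv_sub hq hroot ha (by omega : a ≤ n) (by omega) hb' hab
  have h3 : HasRegularValue (regularDomain q n box) (fun z => (q - q⁻¹) * arg q box z a *
      (arg q box z b - arg q box z a)⁻¹) (fun _ => 1) _ :=
    ((HasRegularValue.const (q - q⁻¹)).mul h1).mul h2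
  refine ((HasRegularValue.const (T q n i)).add
    (h3.smul (HasRegularValue.const (1 : Hecke q n)))).congr fun z hz => ?_
  exact factor_eq i (hz.2 a b ha hlt hb').1

theorem regular_factor (hq : q ≠ 0) (hroot : ∀ k : ℤ, k ≠ 0 → q ^ k ≠ 1) {a b : ℕ}
    (i : ℕ) (ha : 1 ≤ a) (hlt : a < b) (hb' : b ≤ n)
    (hab : content (box a) ≠ content (box b)) :
    Regular (regularDomain q n box) (fun _ => 1)
      (fun z => factor q n i (arg q box z a) (arg q box z b)) :=
  ⟨_, hasRegularValue_factor hq hroot i ha hlt hb' hab⟩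

/-- The boxes of `a` and `a + 1` are in the same principal hook and have adjacent contents. -/
def Linked (box : ℕ → ℕ × ℕ) (a : ℕ) : Prop :=
  hookIndex (box a) = hookIndex (box (a + 1)) ∧
    (content (box (a + 1)) = content (box a) + 1 ∨ content (box (a + 1)) = content (box a) - 1)

/-- Here the restriction to the hook subspace enters: `z_a = z_{a+1}` makes the ratio of arguments
constant on the whole domain, not only at the limit point. -/
theorem Linked.eigen (hq : q ≠ 0) {a : ℕ} (h : Linked box a) (ha : 1 ≤ a) (ha' : a + 1 ≤ n) :
    ∃ β, IsEigen q β ∧ ∀ z ∈ regularDomain q n box,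
      arg q box z a = β ^ 2 * arg q box z (a + 1) := by
  rcases h with ⟨h, h1 | h1⟩
  · refine ⟨q⁻¹, Or.inl rfl, fun z hz => ?_⟩
    have e := hz.1 a (a + 1) ha (by omega) (by omega) ha' h
    simp only [arg, e, h1, mul_add, zpow_add₀ hq]
    have : q ^ (2 * 1 : ℤ) = q ^ 2 := by norm_cast
    rw [this]
    field_simp
  · refine ⟨-q, Or.inr rfl, fun z hz => ?_⟩
    have e := hz.1 a (a + 1) ha (by omega) (by omega) ha' h
    simp only [arg, e, h1, mul_sub, zpow_sub₀ hq]
    have : q ^ (2 * 1 : ℤ) = q ^ 2 := by norm_cast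
    rw [this]
    field_simp

theorem regular_mul_insertProd (hq : q ≠ 0) (hroot : ∀ k : ℤ, k ≠ 0 → q ^ k ≠ 1) {b : ℕ}
    (m : ℕ) (D : List ℕ) (hm : D.length ≤ m) (hD : IsWord n (b :: D))
    (hDs : D.Pairwise (· < ·)) (R : (Fin n → K) → Hecke q n)
    (hR : Regular (regularDomain q n box) (fun _ => 1) R)
    (hs : ∀ a ∈ D, a < b → content (box a) = content (box b) → Linked box a ∧ a + 1 ∈ D ∧
      ∀ z ∈ regularDomain q n box, ∃ W, R z =
        W * factor q n (D.countP (a < ·)) (arg q box z a) (arg q box z (a + 1))) :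
    Regular (regularDomain q n box) (fun _ => 1)
      (fun z => R z * insertProd q n (arg q box z) D b) := by
  have hlen := hD.length_le
  have hb := hD.2 b (by simp)
  have hnd := hD.1
  -- The induction runs over a bound for the length because a letter with a pole is passed together
  -- with its successor.
  induction m generalizing D R with
  | zero =>
    have : D = [] := List.length_eq_zero_iff.1 (by omega)
    subst this
    simpa [insertProd] using hR
  | succ m ih =>
  cases D with
  | nil => simpa [insertProd] using hR
  | cons d D =>
    have hd := hD.2 d (by simp)
    by_cases hdb : d < b
    swap
    · simpa [insertProd, hdb] using hR
    simp only [insertProd, hdb, if_true]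
    simp only [List.length_cons] at hlen hm
    have hlt := (List.pairwise_cons.1 hDs).1
    have hD' : IsWord n (b :: D) := (hD.perm (List.Perm.swap d b D)).cons
    have hcount : ∀ a ∈ D, (d :: D).countP (a < ·) = D.countP (a < ·) := by
      intro a ha
      rw [List.countP_cons_of_neg]
      have := hlt a ha
      simp; omega
    have hcount_lt : ∀ a ∈ D, D.countP (a < ·) < D.length := by
      intro a ha
      refine lt_of_le_of_ne List.countP_le_length fun h => ?_
      have := List.countP_eq_length.1 h a ha
      simp at this
    by_cases hc : content (box d) = content (box b)
    · obtain ⟨hl, hmem, hW⟩ := hs d (by simp) hdb hc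
      have hmem' : d + 1 ∈ D := by simpa using hmem
      have hdb' : d + 1 < b := by
        have h1 : d + 1 ≠ b := by rintro rfl; exact (List.nodup_cons.1 hD'.1).1 hmem'
        omega
      have hne : content (box (d + 1)) ≠ content (box b) := by
        rcases hl.2 with h | h <;> omega
      obtain ⟨β, hβ, hβ'⟩ := hl.eigen (q := q) (n := n) hq hd.1 (by omega)
      cases D with
      | nil => simp at hmem'
      | cons e D =>
        have hlt' := (List.pairwise_cons.1 hDs.of_cons).1
        have he : e = d + 1 := by
          have h1 := hlt e (by simp)
          rcases List.mem_cons.1 hmem' with h | h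
          · exact h.symm
          · have := hlt' _ h; omega
        subst he
        simp only [List.length_cons] at hlen hm hcount_lt
        have hD'' : IsWord n (b :: D) := (hD'.perm (List.Perm.swap (d + 1) b D)).cons
        have hpos : (d :: (d + 1) :: D).countP (d < ·) = D.length + 1 := by
          rw [List.countP_cons_of_neg (by simp), List.countP_eq_length.2]
          · simp
          · intro a ha; simpa using hlt a ha
        simp only [insertProd, hdb', if_true, List.length_cons]
        -- The two factors of `d` and `d + 1` are replaced by the pole-free expression from
        -- `eigen_mul_factor_mul_factor`. The cofactor `W` may itself be singular: it serves only
        -- for the pointwise identity, while `R` is known to be regular.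
        let R' : (Fin n → K) → Hecke q n := fun z => R z *
          (T q n (D.length + 1 + 1) *
            factor q n (D.length + 1) (arg q box z (d + 1)) (arg q box z b) +
          (β * ((q - q⁻¹) * arg q box z (d + 1) *
            (arg q box z b - arg q box z (d + 1))⁻¹)) • (1 : Hecke q n))
        have hR' : Regular (regularDomain q n box) (fun _ => 1) R' := by
          refine hR.mul (Regular.add ((Regular.const _).mul
            (regular_factor hq hroot _ (by omega) hdb' hb.2 hne)) (Regular.smul ?_ (.const _)))
          exact (Regular.const β).mul (((Regular.const _).mul (regular_arg _)).mul
            ⟨_, hasRegularValue_inv_sub hq hroot (by omega) (by omega) (by omega) (by omega) hne⟩)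
        have hRR' : ∀ z ∈ regularDomain q n box, R' z = R z *
            factor q n (D.length + 1 + 1) (arg q box z d) (arg q box z b) *
            factor q n (D.length + 1) (arg q box z (d + 1)) (arg q box z b) := by
          intro z hz
          obtain ⟨W, hW⟩ := hW z hz
          have n1 := (hz.2 d (d + 1) hd.1 (by omega) (by omega))
          have n2 := (hz.2 d b hd.1 hdb hb.2)
          have n3 := (hz.2 (d + 1) b (by omega) hdb' hb.2)
          rw [hpos, factor_eq_of_eigen hq hβ _ n1.1 n1.2 (hβ' z hz)] at hW
          have key := eigen_mul_factor_mul_factor (n := n) hq hβ (i := D.length + 1) (by omega)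
            (by omega) n2.1 n3.1 n2.2 n3.2 (hβ' z hz)
          simp only [R']
          rw [hW, mul_assoc W, ← key]
          simp only [mul_assoc]
        refine (ih D (by omega) hD'' hDs.of_cons.of_cons R' hR' ?_ (by simp; omega) hD''.1).congr
          fun z hz => by rw [hRR' z hz]; simp only [mul_assoc]
        intro a ha hab hac
        obtain ⟨h1, h2, h3⟩ := hs a (by simp [ha]) hab hac
        have hda := hlt a (by simp [ha])
        have hda' := hlt' a ha
        refine ⟨h1, ?_, fun z hz => ?_⟩
        · simp only [List.mem_cons] at h2
          rcases h2 with h2 | h2 | h2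
          · omega
          · omega
          · exact h2
        · obtain ⟨W, hW⟩ := h3 z hz
          have hcnt : (d :: (d + 1) :: D).countP (a < ·) = D.countP (a < ·) := by
            rw [hcount a (by simp [ha]), List.countP_cons_of_neg (by simp; omega)]
          have hcl : D.countP (a < ·) < D.length := by
            refine lt_of_le_of_ne List.countP_le_length fun h => ?_
            have := List.countP_eq_length.1 h a ha
            simp at this
          rw [hcnt] at hW
          refine ⟨W * factor q n (D.length + 1 + 1) (arg q box z d) (arg q box z b) *
            factor q n (D.length + 1) (arg q box z (d + 1)) (arg q box z b), ?_⟩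
          rw [hRR' z hz, hW]
          -- The letter `a` itself is not counted, so both new factors have index at least two above
          -- that of the pair `a, a + 1`, which therefore stays at the right end.
          have c1 := factor_comm (q := q) (n := n) (i := D.countP (a < ·)) (j := D.length + 1 + 1)
            (by omega) (arg q box z a) (arg q box z (a + 1)) (arg q box z d) (arg q box z b)
          have c2 := factor_comm (q := q) (n := n) (i := D.countP (a < ·)) (j := D.length + 1)
            (by omega) (arg q box z a) (arg q box z (a + 1)) (arg q box z (d + 1)) (arg q box z b)
          rw [mul_assoc W, c1.eq, mul_assoc, mul_assoc, c2.eq]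
          simp only [mul_assoc]
    · refine (ih D (by omega) hD' hDs.of_cons (fun z => R z *
        factor q n (D.length + 1) (arg q box z d) (arg q box z b))
        (hR.mul (regular_factor hq hroot _ hd.1 hdb hb.2 hc)) ?_ (by simp; omega) hD'.1).congr
          fun z hz => by simp only [mul_assoc]
      intro a ha hab hac
      obtain ⟨h1, h2, h3⟩ := hs a (by simp [ha]) hab hac
      have hda := hlt a ha
      refine ⟨h1, ?_, fun z hz => ?_⟩
      · rcases List.mem_cons.1 h2 with h2 | h2
        · omega
        · exact h2
      · obtain ⟨W, hW⟩ := h3 z hz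
        rw [hcount a ha] at hW
        have := hcount_lt a ha
        refine ⟨W * factor q n (D.length + 1) (arg q box z d) (arg q box z b), ?_⟩
        rw [hW, mul_assoc, (factor_comm (by omega) _ _ _ _).eq, mul_assoc]

/-- A product over a word is regular if every letter that is inserted meets, together with each
letter `a` of the same content, also `a + 1`, which is linked to `a`. -/
theorem regular_sortProd_append (hq : q ≠ 0) (hroot : ∀ k : ℤ, k ≠ 0 → q ^ k ≠ 1) (L M : List ℕ)
    (hLM : IsWord n (L ++ M))
    (hL : Regular (regularDomain q n box) (fun _ => 1)
      (fun z => sortProd q n (arg q box z) [] L))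
    (hs : ∀ M₁ b M₂, M = M₁ ++ b :: M₂ → ∀ a ∈ L ++ M₁, a < b →
      content (box a) = content (box b) → Linked box a ∧ [a, a + 1].Sublist (L ++ M₁)) :
    Regular (regularDomain q n box) (fun _ => 1)
      (fun z => sortProd q n (arg q box z) [] (L ++ M)) := by
  induction M using List.reverseRecOn with
  | nil => simpa using hL
  | append_singleton M b ih =>
    have e : L ++ (M ++ [b]) = (L ++ M) ++ [b] := by simp
    rw [e] at hLM ⊢
    have ih := ih hLM.left fun M₁ b' M₂ h => hs M₁ b' (M₂ ++ [b]) (by simp [h])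
    simp only [sortProd_concat]
    have hnd := hLM.left.1
    have hmem : ∀ a, a ∈ sortedLetters (L ++ M) ↔ a ∈ L ++ M :=
      fun a => (sortedLetters_perm _).mem_iff
    refine regular_mul_insertProd hq hroot _ _ le_rfl (hLM.perm ?_) (sortedLetters_pairwise hnd) _
      ih fun a ha hab hac => ?_
    · exact (List.perm_append_singleton b _).trans ((sortedLetters_perm _).symm.cons b)
    · obtain ⟨h1, h2⟩ := hs M b [] rfl a ((hmem a).1 ha) hab hac
      refine ⟨h1, (hmem _).2 (h2.subset (by simp)), fun z hz => ?_⟩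
      obtain ⟨W, D₁, D₂, h3, h4⟩ := sortProd_eq_mul_factor hq (generic_arg hz) hLM.left h2
      have hp := sortedLetters_pairwise hnd
      have hpos : (sortedLetters (L ++ M)).countP (a < ·) = D₂.length + 1 := by
        rw [h3, List.pairwise_append] at hp
        rw [h3, List.countP_append, List.countP_eq_zero.2, List.countP_cons_of_neg (by simp),
          List.countP_eq_length.2]
        · simp
        · intro e he
          simpa using (List.pairwise_cons.1 hp.2.1).1 e he
        · intro e he
          have := hp.2.2 e he a (by simp)
          simp; omega
      exact ⟨W, by rw [hpos, h4]⟩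

end Tableau

/-! ### Exchanging two letters of equal content -/

section Exchange

variable {K : Type*} [Field K] {q : K} {n : ℕ}

/-- The factors met when the letter `c`, standing to the right of the word `B` that begins at
position `o`, moves left across `B`. -/
noncomputable def crossLeft (q : K) (n : ℕ) (x : ℕ → K) : ℕ → List ℕ → ℕ → Hecke q n
  | _, [], _ => 1
  | o, b :: B, c => crossLeft q n x (o + 1) B c * factor q n o (x b) (x c)

theorem sortProd_crossLeft {x : ℕ → K} (hq : q ≠ 0) (hx : Generic n x) {c : ℕ} (L₁ L₂ : List ℕ)
    (B : List ℕ) (hB : ∀ b ∈ B, b < c) (hL : IsWord n (L₁ ++ B ++ c :: L₂)) :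
    sortProd q n x [] (L₁ ++ B ++ c :: L₂) =
      crossLeft q n x (L₁.length + 1) B c * sortProd q n x [] (L₁ ++ c :: B ++ L₂) := by
  induction B generalizing L₁ with
  | nil => simp [crossLeft]
  | cons b B ih =>
    have e1 : L₁ ++ b :: B ++ c :: L₂ = (L₁ ++ [b]) ++ B ++ c :: L₂ := by simp
    have e2 : (L₁ ++ [b]) ++ c :: B ++ L₂ = L₁ ++ b :: c :: (B ++ L₂) := by simp
    rw [e1] at hL ⊢
    have hL' : IsWord n ([] ++ (L₁ ++ b :: c :: (B ++ L₂))) := by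
      refine hL.perm ?_
      simp only [List.append_assoc, List.nil_append, List.cons_append]
      exact (List.perm_middle.cons b).append_left _
    rw [ih (L₁ ++ [b]) (fun d hd => hB d (by simp [hd])) hL, e2,
      sortProd_swap hq hx (hB b (by simp)) L₁ (B ++ L₂) [] hL', crossLeft]
    simp [mul_assoc]

variable {box : ℕ → ℕ × ℕ}

theorem regular_crossRight (hq : q ≠ 0) (hroot : ∀ k : ℤ, k ≠ 0 → q ^ k ≠ 1) {a : ℕ} (ha : 1 ≤ a)
    (o : ℕ) (B : List ℕ)
    (hB : ∀ b ∈ B, a < b ∧ b ≤ n ∧ content (box a) ≠ content (box b)) :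
    Regular (regularDomain q n box) (fun _ => 1)
      (fun z => crossRight q n (arg q box z) o a B) := by
  induction B generalizing o with
  | nil => exact .const 1
  | cons b B ih =>
    obtain ⟨h1, h2, h3⟩ := hB b (by simp)
    exact (regular_factor hq hroot o ha h1 h2 h3).mul (ih _ fun c hc => hB c (by simp [hc]))

theorem regular_crossLeft (hq : q ≠ 0) (hroot : ∀ k : ℤ, k ≠ 0 → q ^ k ≠ 1) {c : ℕ} (hc : c ≤ n)
    (o : ℕ) (B : List ℕ)
    (hB : ∀ b ∈ B, 1 ≤ b ∧ b < c ∧ content (box b) ≠ content (box c)) :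
    Regular (regularDomain q n box) (fun _ => 1)
      (fun z => crossLeft q n (arg q box z) o B c) := by
  induction B generalizing o with
  | nil => exact .const 1
  | cons b B ih =>
    obtain ⟨h1, h2, h3⟩ := hB b (by simp)
    exact (ih _ fun c hc => hB c (by simp [hc])).mul (regular_factor hq hroot o h1 h2 hc h3)

/-- If `c` crosses `B` from the right and `a` crosses `B` from the left, then at `x_a = x_c` the
product of the factors is a scalar. -/
theorem crossLeft_mul_crossRight (hq : q ≠ 0) (hroot : ∀ k : ℤ, k ≠ 0 → q ^ k ≠ 1) {a c : ℕ}
    (ha : 1 ≤ a) (hac : content (box a) = content (box c)) (hcn : c ≤ n) (B : List ℕ)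
    (hB : ∀ b ∈ B, a < b ∧ b < c ∧ hookIndex (box b) = hookIndex (box c) ∧
      content (box b) ≠ content (box c)) (o : ℕ) (ho : 1 ≤ o) (hon : o + B.length ≤ n)
    (M Q : (Fin n → K) → Hecke q n) (σ : K)
    (hQ : Regular (regularDomain q n box) (fun _ => 1) Q)
    (hM : ∀ z ∈ regularDomain q n box,
      M z = σ • 1 + (arg q box z c - arg q box z a) • Q z) :
    ∃ (Q' : (Fin n → K) → Hecke q n) (σ' : K),
      Regular (regularDomain q n box) (fun _ => 1) Q' ∧
      (∀ z ∈ regularDomain q n box,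
        crossLeft q n (arg q box z) o B c * M z * crossRight q n (arg q box z) o a B =
          σ' • 1 + (arg q box z c - arg q box z a) • Q' z) ∧
      ((σ = 0 ∨ ∃ b ∈ B, content (box c) = content (box b) + 1) → σ' = 0) := by
  induction B generalizing o M Q σ with
  | nil => exact ⟨Q, σ, hQ, fun z hz => by simpa [crossLeft, crossRight] using hM z hz, by simp⟩
  | cons b B ih =>
    obtain ⟨hab, hbc, hbh, hcb⟩ := hB b (by simp)
    simp only [List.length_cons] at hon
    have hacb : content (box a) ≠ content (box b) := by rw [hac]; exact hcb.symm
    set s : K := swapScalar q (q ^ (2 * content (box b))) (q ^ (2 * content (box c))) with hs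
    let F₁ : (Fin n → K) → Hecke q n := fun z => factor q n o (arg q box z b) (arg q box z c)
    let F₂ : (Fin n → K) → Hecke q n := fun z => factor q n o (arg q box z a) (arg q box z b)
    let g : (Fin n → K) → K := fun z => -((q - q⁻¹) * arg q box z b *
      ((arg q box z b - arg q box z a)⁻¹ * (arg q box z b - arg q box z c)⁻¹))
    -- The product is built from the inside outwards. Replacing `x_a` by `x_c` in `F₂` turns `F₁ F₂`
    -- into the scalar `s`, up to a term divisible by `x_c - x_a`; all these terms are collected in
    -- `Q₁`.
    let Q₁ : (Fin n → K) → Hecke q n := fun z => (σ * g z) • F₁ z + F₁ z * Q z * F₂ z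
    have hF₁ : Regular (regularDomain q n box) (fun _ => 1) F₁ :=
      regular_factor hq hroot o (by omega) hbc hcn hcb
    have hF₂ : Regular (regularDomain q n box) (fun _ => 1) F₂ :=
      regular_factor hq hroot o ha hab (by omega) hacb
    have hg : Regular (regularDomain q n box) (fun _ => 1) g := by
      have h1 : Regular (regularDomain q n box) (fun _ => 1)
          (fun z => (arg q box z b - arg q box z a)⁻¹) :=
        ⟨_, hasRegularValue_inv_sub hq hroot ha (by omega) (by omega) (by omega) hacb⟩
      have h2 : Regular (regularDomain q n box) (fun _ => 1)
          (fun z => (arg q box z b - arg q box z c)⁻¹) :=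
        ⟨_, hasRegularValue_inv_sub hq hroot (by omega) (by omega) (by omega) (by omega) hcb.symm⟩
      exact ((Regular.const (-1 : K)).mul (((Regular.const (q - q⁻¹)).mul (regular_arg b)).mul
        (h1.mul h2))).congr fun z _ => by simp [g]
    have hQ₁ : Regular (regularDomain q n box) (fun _ => 1) Q₁ :=
      ((((Regular.const σ).mul hg).smul hF₁)).add ((hF₁.mul hQ).mul hF₂)
    have hM₁ : ∀ z ∈ regularDomain q n box, F₁ z * M z * F₂ z =
        (σ * s) • 1 + (arg q box z c - arg q box z a) • Q₁ z := by
      intro z hz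
      have n1 := hz.2 a b ha hab (by omega)
      have n2 := hz.2 b c (by omega) hbc hcn
      have hco : coord z b = coord z c :=
        hz.1 b c (by omega) (by omega) (by omega) hcn hbh
      have hcoz : coord z b ≠ 0 := right_ne_zero_of_mul n2.1
      have hcz : arg q box z c ≠ 0 :=
        mul_ne_zero (zpow_ne_zero _ hq) (by rw [← hco]; exact hcoz)
      have e1 := factor_mul_swap (n := n) hq ho (by omega : o < n) n2.1 hcz n2.2
      have e2 := factor_sub_factor (q := q) (n := n) o n1.1 hcz n1.2 n2.2.symm
      have e3 : swapScalar q (arg q box z b) (arg q box z c) = s := by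
        rw [hs, arg, arg, ← hco, swapScalar_mul _ _ hcoz]
      rw [e3] at e1
      have e4 : F₁ z * F₂ z =
          s • 1 + ((arg q box z c - arg q box z a) * g z) • F₁ z := by
        simp only [F₁, F₂, g]
        rw [e2, mul_add, e1, mul_smul_comm, mul_one]
      rw [hM z hz, mul_add, add_mul, mul_smul_comm, mul_one, smul_mul_assoc, e4, mul_smul_comm,
        smul_mul_assoc]
      simp only [Q₁, smul_add, smul_smul, add_assoc]
      congr 2
      ring_nf
    obtain ⟨Q', σ', h1, h2, h3⟩ := ih (fun d hd => hB d (by simp [hd])) (o + 1) (by omega)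
      (by omega) (fun z => F₁ z * M z * F₂ z) Q₁ (σ * s) hQ₁ hM₁
    refine ⟨Q', σ', h1, fun z hz => ?_, fun h => h3 ?_⟩
    · rw [← h2 z hz]
      simp only [crossLeft, crossRight, F₁, F₂, mul_assoc]
    · rcases h with h | ⟨d, hd, hd'⟩
      · exact Or.inl (by simp [h])
      · rcases List.mem_cons.1 hd with rfl | hd
        -- For the adjacent content the arguments satisfy `x_c = q² x_b`, and the scalar vanishes.
        · left
          rw [hs, swapScalar_eq_zero hq (zpow_two_mul_ne hq hroot hcb), mul_zero]
          rw [hd', mul_add, zpow_add₀ hq, mul_comm]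
          norm_cast
        · exact Or.inr ⟨d, hd, hd'⟩

/-- If `c` crosses the letters `B` of its own hook, then the letter `a` with the same content as
`c`, and if then `a` crosses `B`, the product of the factors is regular, provided that a letter of
`B` stands next to `c`. -/
theorem regular_exchange (hq : q ≠ 0) (hroot : ∀ k : ℤ, k ≠ 0 → q ^ k ≠ 1) {a c : ℕ}
    (ha : 1 ≤ a) (hac : content (box a) = content (box c)) (hcn : c ≤ n) (B : List ℕ)
    (hB : ∀ b ∈ B, a < b ∧ b < c ∧ hookIndex (box b) = hookIndex (box c) ∧
      content (box b) ≠ content (box c))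
    (hadj : ∃ b ∈ B, content (box c) = content (box b) + 1) (L₁ L₂ : List ℕ)
    (hL : IsWord n (L₁ ++ a :: B ++ c :: L₂)) :
    ∃ N : (Fin n → K) → Hecke q n, Regular (regularDomain q n box) (fun _ => 1) N ∧
      ∀ z ∈ regularDomain q n box,
        sortProd q n (arg q box z) [] (L₁ ++ a :: B ++ c :: L₂) =
          N z * sortProd q n (arg q box z) [] (L₁ ++ c :: B ++ a :: L₂) := by
  have hac' : a < c := by obtain ⟨b, hb, -⟩ := hadj; exact (hB b hb).1.trans (hB b hb).2.1
  have hlen := hL.length_le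
  simp only [List.length_append, List.length_cons] at hlen
  set o := L₁.length + 1 with ho
  obtain ⟨Q, σ, hQ, hM, hσ⟩ := crossLeft_mul_crossRight (q := q) hq hroot ha hac hcn B hB (o + 1)
    (by omega) (by omega) (fun _ => 1) (fun _ => 0) 1 (.const 0) (fun z _ => by simp)
  have hσ := hσ (Or.inr hadj)
  subst hσ
  have hCL : Regular (regularDomain q n box) (fun _ => 1)
      (fun z => crossLeft q n (arg q box z) (o + 1) B c) :=
    regular_crossLeft hq hroot hcn _ _ fun b hb => by
      obtain ⟨h1, h2, -, h3⟩ := hB b hb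
      exact ⟨by omega, h2, h3⟩
  have hCR : Regular (regularDomain q n box) (fun _ => 1)
      (fun z => crossRight q n (arg q box z) (o + 1) a B) :=
    regular_crossRight hq hroot ha _ _ fun b hb => by
      obtain ⟨h1, h2, -, h3⟩ := hB b hb
      exact ⟨h1, by omega, by rw [hac]; exact h3.symm⟩
  -- Of the factor of `a` and `c`, only the scalar summand has a pole. It multiplies `crossLeft *
  -- crossRight = (x_c - x_a) Q`, which leaves the second term.
  refine ⟨fun z => crossLeft q n (arg q box z) (o + 1) B c * T q n o *
      crossRight q n (arg q box z) (o + 1) a B + ((q - q⁻¹) * arg q box z a) • Q z,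
    ((hCL.mul (.const _)).mul hCR).add (((Regular.const _).mul (regular_arg a)).smul hQ),
    fun z hz => ?_⟩
  have hx := generic_arg hz
  have e1 : L₁ ++ a :: B ++ c :: L₂ = (L₁ ++ [a]) ++ B ++ c :: L₂ := by simp
  have e2 : (L₁ ++ [a]) ++ c :: B ++ L₂ = L₁ ++ a :: c :: (B ++ L₂) := by simp
  have e3 : L₁ ++ c :: a :: (B ++ L₂) = (L₁ ++ [c]) ++ a :: B ++ L₂ := by simp
  have e4 : (L₁ ++ [c]) ++ B ++ a :: L₂ = L₁ ++ c :: B ++ a :: L₂ := by simp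
  rw [e1] at hL ⊢
  have hL₁ : IsWord n ([] ++ (L₁ ++ a :: c :: (B ++ L₂))) := by
    refine hL.perm ?_
    simp only [List.append_assoc, List.nil_append, List.cons_append]
    exact (List.perm_middle.cons a).append_left _
  have hL₂ : IsWord n ([] ++ ((L₁ ++ [c]) ++ a :: B ++ L₂)) := by
    rw [← e3]
    exact hL₁.perm (((List.Perm.swap c a _).append_left _).append_left _)
  rw [sortProd_crossLeft hq hx _ _ B (fun b hb => (hB b hb).2.1) hL, e2,
    sortProd_swap hq hx hac' L₁ (B ++ L₂) [] hL₁, e3,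
    sortProd_crossRight hq hx _ _ [] B (fun b hb => (hB b hb).1) hL₂, e4]
  have hac'' := hz.2 a c ha hac' hcn
  have hd : arg q box z c - arg q box z a ≠ 0 := sub_ne_zero.2 hac''.2.symm
  have hM := hM z hz
  simp only [mul_one, zero_smul, zero_add] at hM
  simp only [List.length_append, List.length_cons, List.length_nil, zero_add, ← ho]
  rw [← mul_assoc, ← mul_assoc, factor_eq o hac''.1, mul_add, add_mul, mul_smul_comm, mul_one,
    smul_mul_assoc, hM, smul_smul, mul_assoc _ (arg q box z c - arg q box z a)⁻¹,
    inv_mul_cancel₀ hd, mul_one]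

end Exchange

/-! ### Combinatorics of the hook tableau -/

section HookBoxes

variable {μ : YoungDiagram}

/-- The order in which the hook tableau fills the boxes. -/
def HookLt (b c : ℕ × ℕ) : Prop :=
  min b.1 b.2 < min c.1 c.2 ∨ (min b.1 b.2 = min c.1 c.2 ∧
    ((b.2 ≤ b.1 ∧ c.1 < c.2) ∨ (b.2 ≤ b.1 ∧ c.2 ≤ c.1 ∧ b.1 < c.1) ∨
      (b.1 < b.2 ∧ c.1 < c.2 ∧ b.2 < c.2)))

theorem HookLt.asymm {b c : ℕ × ℕ} (h : HookLt b c) : ¬ HookLt c b := by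
  unfold HookLt at *; omega

theorem mem_hookBoxes {b : ℕ × ℕ} : b ∈ hookBoxes μ ↔ b ∈ μ := by
  obtain ⟨i, j⟩ := b
  unfold hookBoxes
  simp only [List.mem_flatMap, List.mem_range, List.mem_append, List.mem_map, List.mem_range'_1,
    Prod.mk.injEq]
  constructor
  · rintro ⟨k, -, ⟨x, hx, rfl, rfl⟩ | ⟨x, hx, rfl, rfl⟩⟩
    · exact YoungDiagram.mem_iff_lt_colLen.2 (by omega)
    · exact YoungDiagram.mem_iff_lt_rowLen.2 (by omega)
  · intro h
    have hc := YoungDiagram.mem_iff_lt_colLen.1 h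
    have hr := YoungDiagram.mem_iff_lt_rowLen.1 h
    refine ⟨min i j, ?_, ?_⟩
    · have h0 : (i, 0) ∈ μ := μ.up_left_mem le_rfl (Nat.zero_le _) h
      have h1 := YoungDiagram.mem_iff_lt_colLen.1 h0
      have h2 : μ.colLen 0 ≤ μ.card := by
        rw [YoungDiagram.colLen_eq_card]
        exact Finset.card_le_card (Finset.filter_subset _ _)
      omega
    · rcases le_or_gt j i with hji | hji
      · rw [min_eq_right hji]
        exact Or.inl ⟨i, by omega, rfl, rfl⟩
      · rw [min_eq_left hji.le]
        exact Or.inr ⟨j, by omega, rfl, rfl⟩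

theorem hookBoxes_pairwise : (hookBoxes μ).Pairwise HookLt := by
  unfold hookBoxes
  rw [List.pairwise_flatMap]
  refine ⟨fun k _ => ?_, ?_⟩
  · rw [List.pairwise_append, List.pairwise_map, List.pairwise_map]
    refine ⟨?_, ?_, ?_⟩
    · refine List.Pairwise.imp_of_mem ?_ (List.pairwise_lt_range' (s := k) (n := μ.colLen k - k))
      intro a b ha hb hab
      have := List.mem_range'_1.1 ha
      have := List.mem_range'_1.1 hb
      simp only [HookLt]; omega
    · refine List.Pairwise.imp_of_mem ?_
        (List.pairwise_lt_range' (s := k + 1) (n := μ.rowLen k - (k + 1)))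
      intro a b ha hb hab
      have := List.mem_range'_1.1 ha
      have := List.mem_range'_1.1 hb
      simp only [HookLt]; omega
    · simp only [List.mem_map, List.mem_range'_1]
      rintro _ ⟨a, ha, rfl⟩ _ ⟨b, hb, rfl⟩
      simp only [HookLt]; omega
  · refine List.pairwise_lt_range.imp ?_
    intro k l hkl
    simp only [List.mem_append, List.mem_map, List.mem_range'_1]
    rintro _ (⟨a, ha, rfl⟩ | ⟨a, ha, rfl⟩) _ (⟨b, hb, rfl⟩ | ⟨b, hb, rfl⟩) <;>
      simp only [HookLt] <;> omega

theorem hookBoxes_length : (hookBoxes μ).length = μ.card := by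
  have hnd : (hookBoxes μ).Nodup :=
    hookBoxes_pairwise.imp fun {a b} h => by rintro rfl; exact h.asymm h
  rw [← List.toFinset_card_of_nodup hnd, YoungDiagram.card]
  congr 1
  ext b
  rw [List.mem_toFinset, mem_hookBoxes, YoungDiagram.mem_cells]

theorem hookBox_eq_getElem {a : ℕ} (ha : a - 1 < (hookBoxes μ).length) :
    hookBox μ a = (hookBoxes μ)[a - 1] := by
  unfold hookBox
  simp [List.getD_eq_getElem?_getD, ha]

theorem hookBox_mem {a : ℕ} (h1 : 1 ≤ a) (h2 : a ≤ μ.card) : hookBox μ a ∈ μ := by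
  have h : a - 1 < (hookBoxes μ).length := by rw [hookBoxes_length]; omega
  rw [hookBox_eq_getElem h, ← mem_hookBoxes]
  exact List.getElem_mem h

theorem exists_hookBox_eq {b : ℕ × ℕ} (hb : b ∈ μ) :
    ∃ a, 1 ≤ a ∧ a ≤ μ.card ∧ hookBox μ a = b := by
  obtain ⟨k, hk, rfl⟩ := List.mem_iff_getElem.1 (mem_hookBoxes.2 hb)
  exact ⟨k + 1, by omega, by rw [← hookBoxes_length]; omega, hookBox_eq_getElem (a := k + 1) hk⟩

theorem hookBox_lt {a b : ℕ} (ha : 1 ≤ a) (hab : a < b) (hb : b ≤ μ.card) :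
    HookLt (hookBox μ a) (hookBox μ b) := by
  have h1 : a - 1 < (hookBoxes μ).length := by rw [hookBoxes_length]; omega
  have h2 : b - 1 < (hookBoxes μ).length := by rw [hookBoxes_length]; omega
  rw [hookBox_eq_getElem h1, hookBox_eq_getElem h2]
  exact List.pairwise_iff_getElem.1 hookBoxes_pairwise _ _ h1 h2 (by omega)

theorem lt_of_hookBox_lt {a b : ℕ} (ha : a ≤ μ.card) (hb : 1 ≤ b)
    (h : HookLt (hookBox μ a) (hookBox μ b)) : a < b := by
  rcases lt_trichotomy a b with hab | rfl | hab
  · exact hab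
  · exact absurd h h.asymm
  · exact absurd h (hookBox_lt hb hab ha).asymm

theorem hookBox_injective {a b : ℕ} (ha : 1 ≤ a) (ha' : a ≤ μ.card) (hb : 1 ≤ b)
    (hb' : b ≤ μ.card) (h : hookBox μ a = hookBox μ b) : a = b := by
  rcases lt_trichotomy a b with hab | hab | hab
  · have := hookBox_lt ha hab hb'; rw [h] at this; exact absurd this this.asymm
  · exact hab
  · have := hookBox_lt hb hab ha'; rw [h] at this; exact absurd this this.asymm

theorem hookBox_succ {a : ℕ} {y : ℕ × ℕ} (ha : 1 ≤ a) (ha' : a ≤ μ.card) (hy : y ∈ μ)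
    (h : HookLt (hookBox μ a) y) (hw : ∀ w ∈ μ, HookLt (hookBox μ a) w → ¬ HookLt w y) :
    a + 1 ≤ μ.card ∧ hookBox μ (a + 1) = y := by
  obtain ⟨b, hb, hb', rfl⟩ := exists_hookBox_eq hy
  have hab := lt_of_hookBox_lt ha' hb h
  rcases Nat.lt_or_ge (a + 1) b with h1 | h1
  · exact absurd (hookBox_lt (by omega) h1 hb') (hw _ (hookBox_mem (by omega) (by omega))
      (hookBox_lt ha (by omega) (by omega)))
  · obtain rfl : b = a + 1 := by omega
    exact ⟨hb', rfl⟩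

theorem hookBox_succ_down {a i j : ℕ} (ha : 1 ≤ a) (ha' : a ≤ μ.card)
    (h : hookBox μ a = (i, j)) (hij : j ≤ i) (hy : (i + 1, j) ∈ μ) :
    a + 1 ≤ μ.card ∧ hookBox μ (a + 1) = (i + 1, j) := by
  refine hookBox_succ ha ha' hy ?_ ?_
  · rw [h]; simp only [HookLt]; omega
  · rintro ⟨w₁, w₂⟩ -; rw [h]; simp only [HookLt]; omega

theorem hookBox_succ_right {a i j : ℕ} (ha : 1 ≤ a) (ha' : a ≤ μ.card)
    (h : hookBox μ a = (i, j)) (hij : i < j) (hy : (i, j + 1) ∈ μ) :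
    a + 1 ≤ μ.card ∧ hookBox μ (a + 1) = (i, j + 1) := by
  refine hookBox_succ ha ha' hy ?_ ?_
  · rw [h]; simp only [HookLt]; omega
  · rintro ⟨w₁, w₂⟩ -; rw [h]; simp only [HookLt]; omega

theorem hookBox_add_right {a i j : ℕ} (ha : 1 ≤ a) (ha' : a ≤ μ.card)
    (h : hookBox μ a = (i, j)) (hij : i < j) (t : ℕ) (hy : (i, j + t) ∈ μ) :
    a + t ≤ μ.card ∧ hookBox μ (a + t) = (i, j + t) := by
  induction t with
  | zero => exact ⟨ha', h⟩
  | succ t ih =>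
    obtain ⟨h1, h2⟩ := ih (μ.up_left_mem le_rfl (by omega) hy)
    exact hookBox_succ_right (a := a + t) (j := j + t) (by omega) h1 h2 (by omega) hy

theorem hookBox_succ_hook {a i j : ℕ} (ha : 1 ≤ a) (ha' : a ≤ μ.card)
    (h : hookBox μ a = (i, j)) (hij : i < j) (hj : j + 1 = μ.rowLen i)
    (hy : (i + 1, i + 1) ∈ μ) :
    a + 1 ≤ μ.card ∧ hookBox μ (a + 1) = (i + 1, i + 1) := by
  refine hookBox_succ ha ha' hy ?_ ?_
  · rw [h]; simp only [HookLt]; omega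
  · rintro ⟨w₁, w₂⟩ hw
    have h1 := YoungDiagram.mem_iff_lt_rowLen.1 hw
    have h2 : w₁ = i → w₂ < μ.rowLen i := by rintro rfl; exact h1
    rw [h]; simp only [HookLt]; omega

/-- Two letters `a < b` with the same content: `a` is followed by its neighbour in its hook. -/
theorem hookBox_succ_of_content_eq {a b : ℕ} (ha : 1 ≤ a) (hab : a < b) (hb : b ≤ μ.card)
    (hc : content (hookBox μ a) = content (hookBox μ b)) :
    ((hookBox μ a).2 ≤ (hookBox μ a).1 ∧
        hookBox μ (a + 1) = ((hookBox μ a).1 + 1, (hookBox μ a).2)) ∨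
      ((hookBox μ a).1 < (hookBox μ a).2 ∧
        hookBox μ (a + 1) = ((hookBox μ a).1, (hookBox μ a).2 + 1)) := by
  have hlt := hookBox_lt ha hab hb
  have hmem := hookBox_mem (μ := μ) (a := b) (by omega) hb
  rcases h : hookBox μ a with ⟨i, j⟩
  rcases h' : hookBox μ b with ⟨k, l⟩
  simp only [h, h', content, HookLt] at hlt hc hmem ⊢
  -- The box of `b` lies further down the same diagonal, so the next box of the column or row part
  -- of the hook of `a` is weakly up-left of it and belongs to `μ`.
  rcases le_or_gt j i with hji | hji
  · exact Or.inl ⟨hji, (hookBox_succ_down ha (by omega) h hji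
      (μ.up_left_mem (by omega) (by omega) hmem)).2⟩
  · exact Or.inr ⟨hji, (hookBox_succ_right ha (by omega) h hji
      (μ.up_left_mem (by omega) (by omega) hmem)).2⟩

theorem linked_of_content_eq {a b : ℕ} (ha : 1 ≤ a) (hab : a < b) (hb : b ≤ μ.card)
    (hc : content (hookBox μ a) = content (hookBox μ b)) : Linked (hookBox μ) a := by
  rcases hookBox_succ_of_content_eq ha hab hb hc with ⟨h1, h2⟩ | ⟨h1, h2⟩ <;>
    (unfold Linked; rw [h2]; simp only [hookIndex, content]; omega)

theorem hookIndex_lt_of_content_eq {a b : ℕ} (ha : 1 ≤ a) (hab : a < b) (hb : b ≤ μ.card)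
    (hc : content (hookBox μ a) = content (hookBox μ b)) :
    hookIndex (hookBox μ a) < hookIndex (hookBox μ b) := by
  have := hookBox_lt ha hab hb
  simp only [HookLt, hookIndex, content] at *
  omega

end HookBoxes

/-! ### Regularity of the words left after splitting off the divisor -/

section Position

variable {K : Type*} [Field K] {q : K} {μ : YoungDiagram}

theorem isWord_of_perm_range' {n k : ℕ} {L : List ℕ} (hk : k ≤ n)
    (h : (List.range' 1 k).Perm L) : IsWord n L :=
  IsWord.perm ⟨List.nodup_range', fun a ha => by
    have := List.mem_range'_1.1 ha; omega⟩ h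

theorem pair_sublist_range' {a m k : ℕ} (h1 : m ≤ a) (h2 : a + 1 < m + k) :
    [a, a + 1].Sublist (List.range' m k) := by
  obtain ⟨c, rfl⟩ := Nat.exists_eq_add_of_le h1
  obtain ⟨l, rfl⟩ : ∃ l, k = c + (l + 1 + 1) := ⟨k - c - 2, by omega⟩
  rw [← List.range'_append_1, List.range'_succ, List.range'_succ]
  exact List.Sublist.trans (by simp) (List.sublist_append_right _ _)

theorem range'_eq_append_cons {m k b : ℕ} {M₁ M₂ : List ℕ} (h : List.range' m k = M₁ ++ b :: M₂) :
    m ≤ b ∧ b < m + k ∧ M₁ = List.range' m (b - m) := by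
  have hb := List.mem_range'_1.1 (by rw [h]; simp : b ∈ List.range' m k)
  obtain ⟨l, -, h1, h2⟩ := List.range'_eq_append_iff.1 h
  obtain ⟨h3, -⟩ := List.range'_eq_cons_iff.1 h2.symm
  refine ⟨hb.1, hb.2, ?_⟩
  rw [h1]
  congr 1
  omega

theorem pair_sublist_append {a b : ℕ} {L M : List ℕ} (ha : a ∈ L) (hb : b ∈ M) :
    [a, b].Sublist (L ++ M) :=
  (List.singleton_sublist.2 ha).append (List.singleton_sublist.2 hb)

theorem regular_sortProd_range' (hq : q ≠ 0) (hroot : ∀ k : ℤ, k ≠ 0 → q ^ k ≠ 1) {k : ℕ}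
    (hk : k ≤ μ.card) :
    Regular (regularDomain q μ.card (hookBox μ)) (fun _ => 1)
      (fun z => sortProd q μ.card (arg q (hookBox μ) z) [] (List.range' 1 k)) := by
  have h := regular_sortProd_append (box := hookBox μ) hq hroot [] (List.range' 1 k)
    (isWord_of_perm_range' hk (.refl _)) (Regular.const _) ?_
  · simpa using h
  · intro M₁ b M₂ hM a ha hab hc
    obtain ⟨hb, hb', hM₁⟩ := range'_eq_append_cons hM
    have ha' : a ∈ M₁ := by simpa using ha
    rw [hM₁] at ha' ⊢
    have ha' := List.mem_range'_1.1 ha'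
    have hl := linked_of_content_eq ha'.1 hab (by omega) hc
    have hlt := hookIndex_lt_of_content_eq ha'.1 hab (by omega) hc
    refine ⟨hl, ?_⟩
    -- `a + 1` is in the hook of `a`, whereas `b` is in a later one.
    have : a + 1 ≠ b := by rintro rfl; have := hl.1; omega
    exact pair_sublist_range' (by omega) (by omega)

/-- The letter `a` first crosses `C`, where it meets no equal content, and then changes places with
`c` across `B`. Both products are regular, so regularity passes from the word with `c` before `a` to
the word with `a` before `c`. -/
theorem regular_exchange_of_crossRight {n : ℕ} {box : ℕ → ℕ × ℕ} (hq : q ≠ 0)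
    (hroot : ∀ k : ℤ, k ≠ 0 → q ^ k ≠ 1) {a c : ℕ}
    (ha : 1 ≤ a) (hac : content (box a) = content (box c)) (hcn : c ≤ n) (C B : List ℕ)
    (hC : ∀ b ∈ C, a < b ∧ content (box a) ≠ content (box b))
    (hB : ∀ b ∈ B, a < b ∧ b < c ∧ hookIndex (box b) = hookIndex (box c) ∧
      content (box b) ≠ content (box c))
    (hadj : ∃ b ∈ B, content (box c) = content (box b) + 1) (L₁ L₂ : List ℕ)
    (hL : IsWord n (L₁ ++ C ++ c :: B ++ a :: L₂))
    (hR : Regular (regularDomain q n box) (fun _ => 1)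
      (fun z => sortProd q n (arg q box z) [] (L₁ ++ C ++ c :: B ++ a :: L₂))) :
    IsWord n (L₁ ++ a :: C ++ B ++ c :: L₂) ∧ Regular (regularDomain q n box) (fun _ => 1)
      (fun z => sortProd q n (arg q box z) [] (L₁ ++ a :: C ++ B ++ c :: L₂)) := by
  have e1 : L₁ ++ a :: C ++ B ++ c :: L₂ = L₁ ++ a :: C ++ (B ++ c :: L₂) := by simp
  have e2 : L₁ ++ C ++ a :: (B ++ c :: L₂) = (L₁ ++ C) ++ a :: B ++ c :: L₂ := by simp
  have hL₁ : IsWord n (L₁ ++ a :: C ++ B ++ c :: L₂) := hL.perm (List.perm_iff_count.2 fun x => by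
    simp only [List.count_append, List.count_cons]; omega)
  have hL₂ : IsWord n ((L₁ ++ C) ++ a :: B ++ c :: L₂) := hL.perm (List.perm_iff_count.2 fun x => by
    simp only [List.count_append, List.count_cons]; omega)
  refine ⟨hL₁, ?_⟩
  obtain ⟨N, hN, hN'⟩ := regular_exchange hq hroot ha hac hcn B hB hadj (L₁ ++ C) L₂ hL₂
  have hCR := regular_crossRight (box := box) hq hroot ha (L₁.length + 1) C fun b hb =>
    ⟨(hC b hb).1, (hL.2 b (by simp [hb])).2, (hC b hb).2⟩
  refine ((hCR.mul hN).mul hR).congr fun z hz => ?_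
  rw [e1] at hL₁ ⊢
  rw [sortProd_crossRight hq (generic_arg hz) L₁ _ [] C (fun b hb => (hC b hb).1) hL₁, e2,
    hN' z hz, mul_assoc]
  simp

/-- The letters around a pair `u = p + m + 1`, `v = w + m` of letters with `v` below `u` and
strictly above the diagonal or on it: `u` is in row `i` and `p + 1` is the first letter of the row
part of the hook `i`, while `w + 1` is the first letter of the row part of the hook `i + 1`; the
hook `i` ends with `s`. -/
structure ColumnPosition (μ : YoungDiagram) (i p m s w : ℕ) : Prop where
  le_last : p + m + 1 ≤ s
  last_lt : s < w
  le_card : w + m ≤ μ.card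
  top : ∀ t, 1 ≤ t → t ≤ m + 1 → hookBox μ (p + t) = (i, i + t)
  last : hookIndex (hookBox μ s) = i
  corner : hookBox μ (s + 1) = (i + 1, i + 1)
  bottom : ∀ t, 1 ≤ t → t ≤ m → hookBox μ (w + t) = (i + 1, i + 1 + t)
  bottom_last : hookBox μ (w + m) = (i + 1, i + 1 + m)

namespace ColumnPosition

variable {i p m s w : ℕ}

theorem hookBox_or_lt {a b : ℕ} (ha : 1 ≤ a) (hab : a ≤ b) (hb : b ≤ μ.card) :
    hookBox μ a = hookBox μ b ∨ HookLt (hookBox μ a) (hookBox μ b) := by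
  rcases hab.eq_or_lt with rfl | h
  · exact Or.inl rfl
  · exact Or.inr (hookBox_lt ha h hb)

/-- Together with `block` this separates the contents of `u, …, s` (above `m`) from those of `s + 1,
…, v` (at most `m`), so the divisor has no poles. -/
theorem row (h : ColumnPosition μ i p m s w) {x : ℕ} (h1 : p < x) (h2 : x ≤ s) :
    hookIndex (hookBox μ x) = i ∧ (p + m < x → (m : ℤ) < content (hookBox μ x)) := by
  have g1 := h.last_lt
  have g2 := h.le_card
  have g3 := h.last
  have e1 := h.top 1 le_rfl (by omega)
  have e2 := h.top (m + 1) (by omega) le_rfl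
  have o1 := hookBox_or_lt (μ := μ) (a := p + 1) (b := x) (by omega) h1 (by omega)
  have o2 := hookBox_or_lt (μ := μ) (a := x) (b := s) (by omega) h2 (by omega)
  have o3 : p + m < x → _ := fun hx =>
    hookBox_or_lt (μ := μ) (a := p + (m + 1)) (b := x) (by omega) (by omega) (by omega)
  rw [e1] at o1
  rw [e2] at o3
  generalize hookBox μ x = X at *
  generalize hookBox μ s = S at *
  obtain ⟨x₁, x₂⟩ := X
  obtain ⟨s₁, s₂⟩ := S
  simp only [HookLt, hookIndex, content, Prod.mk.injEq] at *
  constructor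
  · omega
  · intro hx
    have := o3 hx
    omega

theorem block (h : ColumnPosition μ i p m s w) {x : ℕ} (h1 : s < x) (h2 : x ≤ w + m) :
    hookIndex (hookBox μ x) = i + 1 ∧ content (hookBox μ x) ≤ m := by
  have g2 := h.le_card
  have e1 := h.corner
  have e2 := h.bottom_last
  have o1 := hookBox_or_lt (μ := μ) (a := s + 1) (b := x) (by omega) h1 (by omega)
  have o2 := hookBox_or_lt (μ := μ) (a := x) (b := w + m) (by omega) h2 (by omega)
  rw [e1] at o1
  rw [e2] at o2
  generalize hookBox μ x = X at *
  obtain ⟨x₁, x₂⟩ := X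
  simp only [HookLt, hookIndex, content, Prod.mk.injEq] at *
  omega

theorem core (h : ColumnPosition μ i p m s w) {x : ℕ} (h1 : s < x) (h2 : x ≤ w) :
    content (hookBox μ x) ≤ 0 := by
  have hb := h.block h1 (by omega)
  have g2 := h.le_card
  rcases Nat.eq_zero_or_pos m with rfl | hm
  · simpa using hb.2
  · have e := h.bottom 1 le_rfl hm
    have o := hookBox_lt (μ := μ) (a := x) (b := w + 1) (by omega) (by omega) (by omega)
    rw [e] at o
    have hb := hb.1
    generalize hookBox μ x = X at *
    obtain ⟨x₁, x₂⟩ := X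
    simp only [HookLt, hookIndex, content] at *
    omega

/-- Unless `a` is in the row part of hook `i` and `b` in hook `i + 1`, both `a` and its successor
lie in the initial segment `1, …, p`. The case `a = p` is excluded because `p + 1` opens a row part,
so it is not the neighbour of `p` that equal contents would require. -/
theorem succ_le (h : ColumnPosition μ i p m s w) {a b : ℕ} (ha : 1 ≤ a) (hab : a < b)
    (hb : b ≤ w + m) (hpb : p < b) (hc : content (hookBox μ a) = content (hookBox μ b))
    (hs : s < b → ¬ (p < a ∧ a ≤ s)) : a + 1 ≤ p := by
  have g1 := h.last_lt
  have g2 := h.le_card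
  have hlt := hookIndex_lt_of_content_eq ha hab (by omega) hc
  have hl := (linked_of_content_eq ha hab (by omega) hc).1
  rcases Nat.lt_or_ge s b with hsb | hsb
  · have hb' := (h.block hsb hb).1
    have ha' : a ≤ p := by
      by_contra hpa
      have := (h.block (x := a) (by have := hs hsb; omega) (by omega)).1
      omega
    have : a ≠ p := by
      rintro rfl
      have e := h.top 1 le_rfl (by omega)
      rcases hookBox_succ_of_content_eq ha hab (by omega) hc with ⟨h1, h2⟩ | ⟨h1, h2⟩ <;>
        (rw [e, Prod.mk.injEq] at h2; omega)
    omega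
  · have hb' := (h.row hpb hsb).1
    by_contra hpa
    have := (h.row (x := a + 1) (by omega) (by omega)).1
    omega

/-- The idempotents come from the initial segment alone, so the order of the letters of `M` is free.
This permits the reversed block in `crossingWord`. -/
theorem regular_append (h : ColumnPosition μ i p m s w) (hq : q ≠ 0)
    (hroot : ∀ k : ℤ, k ≠ 0 → q ^ k ≠ 1) (L M : List ℕ)
    (hLM : IsWord μ.card (List.range' 1 p ++ L ++ M))
    (hM : ∀ b ∈ M, p < b ∧ b ≤ w + m)
    (hs : (∀ b ∈ M, b ≤ s) ∨ ∀ a ∈ L ++ M, s < a)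
    (hL : Regular (regularDomain q μ.card (hookBox μ)) (fun _ => 1)
      (fun z => sortProd q μ.card (arg q (hookBox μ) z) [] (List.range' 1 p ++ L))) :
    Regular (regularDomain q μ.card (hookBox μ)) (fun _ => 1)
      (fun z => sortProd q μ.card (arg q (hookBox μ) z) [] (List.range' 1 p ++ L ++ M)) := by
  refine regular_sortProd_append hq hroot _ _ hLM hL fun M₁ b M₂ hb a ha hab hc => ?_
  have hbM : b ∈ M := by rw [hb]; simp
  have hb' := hM b hbM
  have g2 := h.le_card
  have ha1 : 1 ≤ a := (hLM.2 a (by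
    rw [hb, ← List.append_assoc]; exact List.mem_append_left _ ha)).1
  refine ⟨linked_of_content_eq ha1 hab (by omega) hc, ?_⟩
  have := h.succ_le ha1 hab hb'.2 hb'.1 hc (by
    intro hsb
    rcases hs with hs | hs
    · have := hs b hbM; omega
    · rw [List.append_assoc] at ha
      rcases List.mem_append.1 ha with ha | ha
      · have := List.mem_range'_1.1 ha; omega
      · have := hs a (by
          rw [hb, ← List.append_assoc]; exact List.mem_append_left _ ha)
        omega)
  rw [List.append_assoc]
  exact (pair_sublist_range' ha1 (by omega)).trans (List.sublist_append_left _ _)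

/-- The word in which the letters of the row `i` with content `1, …, t` have not yet crossed the
block of the hook `i + 1`, while the other ones, up to content `m`, have. -/
def crossingWord (p m s w t : ℕ) : List ℕ :=
  (List.range' 1 p ++ List.range' (p + 1) t) ++ (List.range' (w + t + 1) (m - t)).reverse ++
    (List.range' (s + 1) (w - s) ++ List.range' (w + 1) t) ++ List.range' (p + t + 1) (m - t)

/-- For `t = 0` the lower block precedes the row letters, so it meets no equal content outside `1,
…, p` and the criterion applies. Each step exchanges the two letters of content `t + 1`; the
reversed order of the waiting letters leaves between them, on the right side, only contents at most
`t`. -/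
theorem regular_crossingWord (h : ColumnPosition μ i p m s w) (hq : q ≠ 0)
    (hroot : ∀ k : ℤ, k ≠ 0 → q ^ k ≠ 1) {t : ℕ} (ht : t ≤ m) :
    IsWord μ.card (crossingWord p m s w t) ∧
      Regular (regularDomain q μ.card (hookBox μ)) (fun _ => 1)
        (fun z => sortProd q μ.card (arg q (hookBox μ) z) [] (crossingWord p m s w t)) := by
  have g0 := h.le_last
  have g1 := h.last_lt
  have g2 := h.le_card
  induction t with
  | zero =>
    have e : crossingWord p m s w 0 = List.range' 1 p ++
        ((List.range' (w + 1) m).reverse ++ List.range' (s + 1) (w - s)) ++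
        List.range' (p + 1) m := by
      simp [crossingWord]
    have hw : IsWord μ.card (crossingWord p m s w 0) := by
      rw [e]
      constructor
      · simp only [List.nodup_append, List.nodup_reverse, List.mem_append,
          List.mem_reverse, List.mem_range'_1]
        and_intros <;> first | exact List.nodup_range' | (intros; omega)
      · simp only [List.mem_append, List.mem_reverse, List.mem_range'_1]
        intros; omega
    refine ⟨hw, ?_⟩
    rw [e] at hw ⊢
    refine h.regular_append hq hroot _ _ hw ?_ (Or.inl ?_) ?_
    · intro b hb; have := List.mem_range'_1.1 hb; omega
    · intro b hb; have := List.mem_range'_1.1 hb; omega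
    · have := h.regular_append hq hroot []
        ((List.range' (w + 1) m).reverse ++ List.range' (s + 1) (w - s))
        (by simpa using hw.left) ?_ (Or.inr ?_)
        (by simpa using regular_sortProd_range' hq hroot (by omega))
      · simpa using this
      · simp only [List.mem_append, List.mem_reverse, List.mem_range'_1]
        intros; omega
      · simp only [List.mem_append, List.nil_append, List.mem_reverse, List.mem_range'_1]
        intros; omega
  | succ t ih =>
    obtain ⟨ih1, ih2⟩ := ih (by omega)
    obtain ⟨k, rfl⟩ : ∃ k, m = t + 1 + k := ⟨m - (t + 1), by omega⟩
    have e1 : crossingWord p (t + 1 + k) s w t =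
        (List.range' 1 p ++ List.range' (p + 1) t) ++ (List.range' (w + t + 2) k).reverse ++
          (w + t + 1) :: (List.range' (s + 1) (w - s) ++ List.range' (w + 1) t) ++
          (p + t + 1) :: List.range' (p + t + 2) k := by
      rw [crossingWord, show t + 1 + k - t = k + 1 by omega, List.range'_succ, List.range'_succ]
      simp
    have e2 : crossingWord p (t + 1 + k) s w (t + 1) =
        (List.range' 1 p ++ List.range' (p + 1) t) ++ (p + t + 1) ::
          (List.range' (w + t + 2) k).reverse ++
          (List.range' (s + 1) (w - s) ++ List.range' (w + 1) t) ++
          (w + t + 1) :: List.range' (p + t + 2) k := by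
      rw [crossingWord, show t + 1 + k - (t + 1) = k by omega, List.range'_1_concat,
        List.range'_1_concat]
      simp [add_assoc, add_comm, add_left_comm]
    rw [e1] at ih1 ih2
    rw [e2]
    have ca : hookBox μ (p + t + 1) = (i, i + (t + 1)) := h.top (t + 1) (by omega) (by omega)
    have cc : ∀ j, 1 ≤ j → j ≤ t + 1 + k → content (hookBox μ (w + j)) = j := by
      intro j h1 h2
      rw [h.bottom j h1 h2]
      simp [content]
    have cc1 : content (hookBox μ (w + t + 1)) = t + 1 := by
      have := cc (t + 1) (by omega) (by omega)
      rw [← add_assoc] at this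
      simpa using this
    have ca1 : content (hookBox μ (p + t + 1)) = t + 1 := by
      rw [ca]; simp [content]
    have hi := fun x h1 h2 => (h.block (x := x) h1 h2).1
    refine regular_exchange_of_crossRight hq hroot (by omega) (by rw [ca1, cc1]) (by omega) _ _
      ?_ ?_ ?_ _ _ ih1 ih2
    · intro b hb
      simp only [List.mem_reverse, List.mem_range'_1] at hb
      obtain ⟨j, rfl⟩ : ∃ j, b = w + j := ⟨b - w, by omega⟩
      have := cc j (by omega) (by omega)
      exact ⟨by omega, by rw [ca1, this]; omega⟩
    · intro b hb
      simp only [List.mem_append, List.mem_range'_1] at hb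
      refine ⟨by omega, by omega, ?_, ?_⟩
      · rw [hi b (by omega) (by omega), hi _ (by omega) (by omega)]
      · rw [cc1]
        rcases hb with hb | hb
        · have := h.core (x := b) (by omega) (by omega)
          omega
        · obtain ⟨j, rfl⟩ : ∃ j, b = w + j := ⟨b - w, by omega⟩
          have := cc j (by omega) (by omega)
          omega
    -- The letter of content `t` provides the vanishing scalar; for `t = 0` it is the corner `s + 1`
    -- of the lower hook.
    · rw [cc1]
      rcases Nat.eq_zero_or_pos t with rfl | ht0
      · refine ⟨s + 1, ?_, ?_⟩
        · simp only [List.mem_append, List.mem_range'_1]; omega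
        · rw [h.corner]; simp [content]
      · refine ⟨w + t, ?_, ?_⟩
        · simp only [List.mem_append, List.mem_range'_1]; omega
        · rw [cc t ht0 (by omega)]

/-- For `t = m` the crossing word consists of the increasing words `1, …, u - 1` and `s + 1, …, v`.
The remaining letters again satisfy the criterion, since `u - 1` now precedes `u`. -/
theorem regular_rest (h : ColumnPosition μ i p m s w) (hq : q ≠ 0)
    (hroot : ∀ k : ℤ, k ≠ 0 → q ^ k ≠ 1) (k l : ℕ) (hk : p + m + k = s)
    (hl : w + m + l = μ.card) :
    Regular (regularDomain q μ.card (hookBox μ)) (fun _ => 1)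
      (fun z => sortProd q μ.card (arg q (hookBox μ) z) []
        (List.range' 1 (p + m) ++ List.range' (s + 1) (w + m - s) ++
          List.range' (p + m + 1) k ++ List.range' (w + m + 1) l)) := by
  have g0 := h.le_last
  have g1 := h.last_lt
  have g2 := h.le_card
  have e0 : crossingWord p m s w m = List.range' 1 (p + m) ++ List.range' (s + 1) (w + m - s) := by
    have e1 := List.range'_append_1 (s := 1) (m := p) (n := m)
    have e2 := List.range'_append_1 (s := s + 1) (m := w - s) (n := m)
    rw [show s + 1 + (w - s) = w + 1 by omega, show w - s + m = w + m - s by omega] at e2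
    rw [← e2, ← e1, crossingWord]
    simp [add_comm]
  have hw : IsWord μ.card (List.range' 1 (p + m) ++ List.range' (s + 1) (w + m - s) ++
      List.range' (p + m + 1) k ++ List.range' (w + m + 1) l) := by
    constructor
    · simp only [List.nodup_append, List.mem_append, List.mem_range'_1]
      and_intros <;> first | exact List.nodup_range' | (intros; omega)
    · simp only [List.mem_append, List.mem_range'_1]
      intros; omega
  have h1 := (h.regular_crossingWord hq hroot le_rfl).2
  rw [e0] at h1
  have e3 : List.range' 1 (p + m) = List.range' 1 p ++ List.range' (p + 1) m := by
    have e1 := List.range'_append_1 (s := 1) (m := p) (n := m)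
    rw [← e1, add_comm 1 p]
  have h2 : Regular (regularDomain q μ.card (hookBox μ)) (fun _ => 1)
      (fun z => sortProd q μ.card (arg q (hookBox μ) z) []
        (List.range' 1 (p + m) ++ List.range' (s + 1) (w + m - s) ++
          List.range' (p + m + 1) k)) := by
    have hw' := hw.left
    rw [e3, List.append_assoc (List.range' 1 p)] at h1 hw' ⊢
    refine h.regular_append hq hroot _ _ hw' ?_ (Or.inl ?_) h1
    · intro b hb; have := List.mem_range'_1.1 hb; omega
    · intro b hb; have := List.mem_range'_1.1 hb; omega
  refine regular_sortProd_append hq hroot _ _ hw h2 fun M₁ b M₂ hM a ha hab hc => ?_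
  obtain ⟨hb, hb', hM₁⟩ := range'_eq_append_cons hM
  have ha1 : 1 ≤ a := by
    rw [hM₁] at ha
    simp only [List.mem_append, List.mem_range'_1] at ha
    omega
  have hln := linked_of_content_eq ha1 hab (by omega) hc
  have hlt := hookIndex_lt_of_content_eq ha1 hab (by omega) hc
  have hne : a + 1 ≠ b := by rintro rfl; have := hln.1; omega
  -- Only here could the successor stand before its letter: `s + 1` precedes `s` in this word. But
  -- `s` ends its hook and is not linked to `s + 1`.
  have hns : a ≠ s := by
    rintro rfl
    have e1 := h.last
    have e2 := hln.1
    rw [h.corner, e1] at e2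
    simp [hookIndex] at e2
  refine ⟨hln, ?_⟩
  rw [hM₁]
  rcases Nat.lt_or_ge (p + m) a with c1 | c1
  · rcases Nat.lt_or_ge s a with c2 | c2
    · rcases Nat.lt_or_ge (w + m) a with c3 | c3
      · exact (pair_sublist_range' (by omega) (by omega)).trans (List.sublist_append_right _ _)
      · rcases Nat.lt_or_ge a (w + m) with c4 | c4
        · exact (pair_sublist_range' (by omega) (by omega)).trans
            ((List.sublist_append_right _ _).trans ((List.sublist_append_left _ _).trans
              (List.sublist_append_left _ _)))
        · refine pair_sublist_append ?_ ?_ <;>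
            simp only [List.mem_append, List.mem_range'_1] <;> omega
    · exact (pair_sublist_range' (by omega) (by omega)).trans
        ((List.sublist_append_right _ _).trans (List.sublist_append_left _ _))
  · rcases Nat.lt_or_ge a (p + m) with c2 | c2
    · exact (pair_sublist_range' (by omega) (by omega)).trans
        ((List.sublist_append_left _ _).trans ((List.sublist_append_left _ _).trans
          (List.sublist_append_left _ _)))
    · refine (pair_sublist_append ?_ ?_).trans (List.sublist_append_left _ _) <;>
        simp only [List.mem_append, List.mem_range'_1] <;> omega

end ColumnPosition

end Position

/-! ### Existence, uniqueness and the two divisibilities -/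

section Main

variable {K : Type*} [Field K] {q : K} {μ : YoungDiagram}

theorem fusionProduct_eq_sortProd {n : ℕ} {box : ℕ → ℕ × ℕ} (z : Fin n → K) :
    fusionProduct q n box z = sortProd q n (arg q box z) [] (List.range' 1 n) :=
  (sortProd_range' n).symm

theorem infinite_of_zpow_ne_one (hq : q ≠ 0) (hroot : ∀ k : ℤ, k ≠ 0 → q ^ k ≠ 1) :
    Infinite K :=
  Infinite.of_injective (fun k : ℤ => q ^ k) fun k l h => by
    by_contra hkl
    refine hroot (k - l) (sub_ne_zero.2 hkl) ?_
    have h : q ^ k = q ^ l := h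
    rw [zpow_sub₀ hq, h, div_self (zpow_ne_zero _ hq)]

theorem finite_linear_roots {α β : K} (h : α ≠ 0 ∨ β ≠ 0) : {e : K | α + e * β = 0}.Finite := by
  refine Set.Subsingleton.finite fun e he e' he' => ?_
  have he : α + e * β = 0 := he
  have he' : α + e' * β = 0 := he'
  have hβ : β ≠ 0 := by
    rintro rfl
    rcases h with h | h
    · exact h (by simpa using he)
    · exact h rfl
  have : (e - e') * β = 0 := by linear_combination he - he'
  exact sub_eq_zero.1 ((mul_eq_zero.1 this).resolve_right hβ)

/-- The line through `(1, …, 1)` whose direction is `q^k` on the `k`-th principal hook meets the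
regular domain in infinitely many points. -/
theorem infinite_line_inter_regularDomain (hq : q ≠ 0) (hroot : ∀ k : ℤ, k ≠ 0 → q ^ k ≠ 1) :
    {e : K | (fun _ => 1) + e • (fun i : Fin μ.card =>
      q ^ (hookIndex (hookBox μ (i + 1)))) ∈ regularDomain q μ.card (hookBox μ)}.Infinite := by
  have := infinite_of_zpow_ne_one hq hroot
  set d : Fin μ.card → K := fun i => q ^ (hookIndex (hookBox μ (i + 1))) with hd
  have hcoord : ∀ (e : K) (a : ℕ), 1 ≤ a → a ≤ μ.card →
      coord ((fun _ => 1) + e • d) a = 1 + e * q ^ (hookIndex (hookBox μ a)) := by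
    intro e a h1 h2
    rw [coord_of_le h1 h2]
    simp [hd, Nat.sub_add_cancel h1]
  let B : ℕ → ℕ → Set K := fun a b =>
    {e | 1 + e * q ^ (hookIndex (hookBox μ a)) = 0} ∪
    {e | (q ^ (2 * content (hookBox μ a)) - q ^ (2 * content (hookBox μ b))) +
      e * (q ^ (2 * content (hookBox μ a)) * q ^ (hookIndex (hookBox μ a)) -
        q ^ (2 * content (hookBox μ b)) * q ^ (hookIndex (hookBox μ b))) = 0}
  let S : Finset (ℕ × ℕ) := (Finset.Icc 1 μ.card ×ˢ Finset.Icc 1 μ.card).filter fun x => x.1 < x.2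
  have hfin : (⋃ x ∈ S, B x.1 x.2).Finite := by
    refine S.finite_toSet.biUnion fun x hx => ?_
    simp only [S, Finset.coe_filter, Finset.mem_product, Finset.mem_Icc, Set.mem_ofPred_eq] at hx
    refine (finite_linear_roots (Or.inl one_ne_zero)).union (finite_linear_roots ?_)
    -- Two arguments differ at all but at most one point of the line: for equal contents the hooks,
    -- and hence the directions `q^k`, differ; for different contents the arguments already differ
    -- at `e = 0`.
    by_cases hc : content (hookBox μ x.1) = content (hookBox μ x.2)
    · right
      have hlt := hookIndex_lt_of_content_eq hx.1.1.1 hx.2 hx.1.2.2 hc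
      rw [hc, ← mul_sub]
      refine mul_ne_zero (zpow_ne_zero _ hq) (sub_ne_zero.2 fun h => ?_)
      refine hroot ((hookIndex (hookBox μ x.1) : ℤ) - hookIndex (hookBox μ x.2)) (by omega) ?_
      rw [zpow_sub₀ hq, zpow_natCast, zpow_natCast, h, div_self (pow_ne_zero _ hq)]
    · exact Or.inl (sub_ne_zero.2 (zpow_two_mul_ne hq hroot hc))
  refine hfin.infinite_compl.mono fun e he => ?_
  simp only [Set.mem_compl_iff, Set.mem_iUnion, not_exists] at he
  refine ⟨?_, ?_⟩
  · intro a b ha ha' hb hb' h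
    rw [hcoord e a ha ha', hcoord e b hb hb', h]
  · intro a b ha hab hb
    have h := he (a, b) (by simp [S]; omega)
    simp only [B, Set.mem_union, Set.mem_ofPred_eq, not_or] at h
    simp only [arg, hcoord e a ha (by omega), hcoord e b (by omega) hb]
    refine ⟨mul_ne_zero (zpow_ne_zero _ hq) h.1, fun h' => h.2 ?_⟩
    linear_combination h'

theorem regularValue_unique (hq : q ≠ 0) (hroot : ∀ k : ℤ, k ≠ 0 → q ^ k ≠ 1)
    {f : (Fin μ.card → K) → Hecke q μ.card} {v w : Hecke q μ.card}
    (hv : HasRegularValue (regularDomain q μ.card (hookBox μ)) f (fun _ => 1) v)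
    (hw : HasRegularValue (regularDomain q μ.card (hookBox μ)) f (fun _ => 1) w) : v = w :=
  hv.unique hw _ (infinite_line_inter_regularDomain hq hroot)

theorem factor_smul (n i : ℕ) {t : K} (ht : t ≠ 0) (a b : K) :
    factor q n i (t * a) (t * b) = factor q n i a b := by
  unfold factor
  have : (t * a)⁻¹ * (t * b) = a⁻¹ * b := by
    rw [mul_inv]
    field_simp
  rw [this]

theorem coord_smul {n : ℕ} (t : K) (z : Fin n → K) (a : ℕ) : coord (t • z) a = t * coord z a := by
  unfold coord
  split_ifs <;> simp

theorem arg_smul {n : ℕ} {box : ℕ → ℕ × ℕ} (t : K) (z : Fin n → K) (a : ℕ) :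
    arg q box (t • z) a = t * arg q box z a := by
  unfold arg
  rw [coord_smul]
  ring

theorem smul_mem_regularDomain {n : ℕ} {box : ℕ → ℕ × ℕ} {t : K} (ht : t ≠ 0) {z : Fin n → K}
    (hz : z ∈ regularDomain q n box) : t • z ∈ regularDomain q n box := by
  refine ⟨Submodule.smul_mem _ _ hz.1, fun i j hi hij hj => ?_⟩
  obtain ⟨h1, h2⟩ := hz.2 i j hi hij hj
  rw [arg_smul, arg_smul]
  exact ⟨mul_ne_zero ht h1, fun h => h2 (mul_left_cancel₀ ht h)⟩

theorem fusionProduct_smul {n : ℕ} {box : ℕ → ℕ × ℕ} {t : K} (ht : t ≠ 0) (z : Fin n → K) :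
    fusionProduct q n box (t • z) = fusionProduct q n box z := by
  simp only [fusionProduct, arg_smul, factor_smul _ _ ht]

/-- The factors depend only on ratios of arguments, so regularity at `(1, …, 1)` carries over to
every `(t, …, t)` with the same value. -/
theorem exists_isFusionElement (hq : q ≠ 0) (hroot : ∀ k : ℤ, k ≠ 0 → q ^ k ≠ 1) :
    ∃ F : Hecke q μ.card, IsFusionElement q μ F := by
  obtain ⟨F, hF⟩ := (regular_sortProd_range' (μ := μ) hq hroot le_rfl).congr
    fun z _ => fusionProduct_eq_sortProd z
  refine ⟨F, fun t ht => ?_⟩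
  have h := hF.scale ht (fun z hz => smul_mem_regularDomain (inv_ne_zero ht) hz)
    (fun z _ => fusionProduct_smul (inv_ne_zero ht) z)
  have e : (fun _ => t : Fin μ.card → K) = t • (fun _ => 1) := by ext; simp
  rw [e]
  exact h

theorem IsFusionElement.hasRegularValue {F : Hecke q μ.card} (h : IsFusionElement q μ F) :
    HasRegularValue (regularDomain q μ.card (hookBox μ))
      (fun z => sortProd q μ.card (arg q (hookBox μ) z) [] (List.range' 1 μ.card)) (fun _ => 1) F :=
  (h 1 one_ne_zero).congr fun z _ => (fusionProduct_eq_sortProd z).symm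

theorem factor_of_content_eq_sub_one (hq : q ≠ 0) (hroot : ∀ k : ℤ, k ≠ 0 → q ^ k ≠ 1) {n i : ℕ}
    {c d : ℤ} (h : d = c - 1) {z : K} (hz : z ≠ 0) :
    factor q n i (q ^ (2 * c) * z) (q ^ (2 * d) * z) = T q n i - algebraMap K (Hecke q n) q := by
  rw [factor_eq_of_eigen hq (β := -q) (Or.inr rfl) i (mul_ne_zero (zpow_ne_zero _ hq) hz),
    Algebra.algebraMap_eq_smul_one, neg_smul, sub_eq_add_neg]
  · intro e
    exact zpow_two_mul_ne hq hroot (by omega : c ≠ d) (mul_right_cancel₀ hz e)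
  · rw [h, mul_sub, zpow_sub₀ hq]
    have : q ^ (2 * 1 : ℤ) = q ^ 2 := by norm_cast
    rw [this]
    field_simp

theorem isFusionElement_eq_mul_of_content_neg (hq : q ≠ 0) (hroot : ∀ k : ℤ, k ≠ 0 → q ^ k ≠ 1)
    {F : Hecke q μ.card} (hF : IsFusionElement q μ F) {u : ℕ} (hu : 1 ≤ u) (hu' : u + 1 ≤ μ.card)
    (hc : content (hookBox μ (u + 1)) = content (hookBox μ u) - 1)
    (hh : hookIndex (hookBox μ u) = hookIndex (hookBox μ (u + 1))) :
    ∃ Y, F = (T q μ.card u - algebraMap K (Hecke q μ.card) q) * Y := by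
  -- Annihilation is a statement about values and passes to the limit by uniqueness, without any
  -- regularity of the cofactor of `T_u - q`.
  have hzero : (T q μ.card u + algebraMap K (Hecke q μ.card) q⁻¹) * F = 0 := by
    refine regularValue_unique hq hroot
      ((HasRegularValue.const (T q μ.card u + algebraMap K (Hecke q μ.card) q⁻¹)).mul
        hF.hasRegularValue) ((HasRegularValue.const 0).congr fun z hz => ?_)
    obtain ⟨l, hl⟩ : ∃ l, μ.card = (u - 1) + (l + 1 + 1) := ⟨μ.card - u - 1, by omega⟩
    have e : List.range' 1 μ.card = List.range' 1 (u - 1) ++ u :: (u + 1) ::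
        List.range' (u + 1 + 1) l := by
      rw [hl, ← List.range'_append_1, List.range'_succ, List.range'_succ,
        show 1 + (u - 1) = u by omega]
    have hw : IsWord μ.card ([] ++ (List.range' 1 (u - 1) ++ u :: (u + 1) ::
        List.range' (u + 1 + 1) l)) := by
      rw [List.nil_append, ← e]
      exact isWord_of_perm_range' le_rfl (.refl _)
    have hz' := hz.2 u (u + 1) hu (by omega) hu'
    have hcoord := hz.1 u (u + 1) hu (by omega) (by omega) hu' hh
    have hcu : coord z u ≠ 0 := right_ne_zero_of_mul hz'.1
    have hfac : factor q μ.card u (arg q (hookBox μ) z u) (arg q (hookBox μ) z (u + 1)) =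
        T q μ.card u - algebraMap K (Hecke q μ.card) q := by
      rw [arg, arg, ← hcoord]
      exact factor_of_content_eq_sub_one hq hroot hc hcu
    rw [e, sortProd_swap hq (generic_arg hz) (by omega) _ _ [] hw]
    have hl : ([] : List ℕ).length + (List.range' 1 (u - 1)).length + 1 = u := by
      simp; omega
    rw [hl, hfac, ← mul_assoc]
    have hcomm : (T q μ.card u + algebraMap K (Hecke q μ.card) q⁻¹) *
        (T q μ.card u - algebraMap K (Hecke q μ.card) q) = 0 := by
      rw [← T_quadratic (q := q) (n := μ.card) hu (by omega)]
      refine Commute.eq ?_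
      refine Commute.add_left ?_ (Algebra.commutes _ _)
      exact (Commute.refl _).sub_right (Algebra.commutes q (T q μ.card u)).symm
    rw [hcomm, zero_mul]
  have h2 : q + q⁻¹ ≠ 0 := by
    intro h
    refine hroot 4 (by norm_num) ?_
    have h3 : q ^ 2 = -1 := by
      field_simp at h
      linear_combination h
    have : q ^ (4 : ℤ) = (q ^ 2) ^ 2 := by norm_cast; ring
    rw [this, h3]; norm_num
  -- From `T_u F = -q⁻¹ F` follows `(T_u - q) F = -(q + q⁻¹) F`.
  refine ⟨(-(q + q⁻¹)⁻¹) • F, ?_⟩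
  have h4 : T q μ.card u * F = -(q⁻¹ • F) := by
    rw [add_mul, Algebra.algebraMap_eq_smul_one, smul_mul_assoc, one_mul] at hzero
    exact eq_neg_of_add_eq_zero_left hzero
  rw [mul_smul_comm, sub_mul, Algebra.algebraMap_eq_smul_one, smul_mul_assoc, one_mul, h4]
  have h5 : (q + q⁻¹)⁻¹ * (q + q⁻¹) = 1 := inv_mul_cancel₀ h2
  calc F = (1 : K) • F := (one_smul _ _).symm
    _ = ((q + q⁻¹)⁻¹ * (q + q⁻¹)) • F := by rw [h5]
    _ = _ := by module

theorem isFusionElement_eq_columnDivisor_mul (hq : q ≠ 0) (hroot : ∀ k : ℤ, k ≠ 0 → q ^ k ≠ 1)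
    {F : Hecke q μ.card} (hF : IsFusionElement q μ F) {i p m s w : ℕ}
    (h : ColumnPosition μ i p m s w) :
    ∃ Y, F = columnDivisor q μ (p + m + 1) (w + m) s * Y := by
  have g0 := h.le_last
  have g1 := h.last_lt
  have g2 := h.le_card
  obtain ⟨k, hk⟩ : ∃ k, p + m + k = s := ⟨s - (p + m), by omega⟩
  obtain ⟨l, hl⟩ : ∃ l, w + m + l = μ.card := ⟨μ.card - (w + m), by omega⟩
  obtain ⟨Y, hY⟩ := h.regular_rest hq hroot k l hk hl
  have hD : HasRegularValue (regularDomain q μ.card (hookBox μ))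
      (fun z => ((List.range' (p + m + 1) k).reverse.map fun i =>
        crossRight q μ.card (arg q (hookBox μ) z)
          ((List.range' 1 (p + m)).length + i + 1 - (p + m + 1)) i
          (List.range' (s + 1) (w + m - s))).prod) (fun _ => 1)
      (columnDivisor q μ (p + m + 1) (w + m) s) := by
    unfold columnDivisor
    rw [show s + 1 - (p + m + 1) = k by omega]
    refine HasRegularValue.list_prod _ fun a ha => ?_
    simp only [List.mem_reverse, List.mem_range'_1] at ha
    simp only [crossRight_range']
    refine HasRegularValue.list_prod _ fun b hb => ?_
    have hb := List.mem_range'_1.1 hb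
    rw [List.length_range', show p + m + a + 1 - (p + m + 1) + b - (s + 1) = a + b - s - 1 by omega]
    refine hasRegularValue_factor hq hroot _ (by omega) (by omega) (by omega) ?_
    have h1 := (h.row (x := a) (by omega) (by omega)).2 (by omega)
    have h2 := (h.block (x := b) (by omega) (by omega)).2
    omega
  refine ⟨Y, regularValue_unique hq hroot hF.hasRegularValue ((hD.mul hY).congr fun z hz => ?_)⟩
  have e : List.range' 1 μ.card = List.range' 1 (p + m) ++ List.range' (p + m + 1) k ++
      List.range' (s + 1) (w + m - s) ++ List.range' (w + m + 1) l := by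
    have e1 := List.range'_append_1 (s := 1) (m := p + m) (n := k)
    have e2 := List.range'_append_1 (s := 1) (m := s) (n := w + m - s)
    have e3 := List.range'_append_1 (s := 1) (m := w + m) (n := l)
    rw [hl, ← show s + (w + m - s) = w + m by omega, ← e2] at e3
    rw [hk, add_comm 1 (p + m)] at e1
    rw [← e3, ← e1, add_comm 1 s]
    congr 2
    omega
  rw [e]
  refine sortProd_crossBlock hq (generic_arg hz) _ _ _ _ _ ?_ ?_
  · intro b hb
    have := List.mem_range'_1.1 hb
    omega
  · rw [← e]
    exact isWord_of_perm_range' le_rfl (.refl _)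

theorem exists_columnPosition {u v s : ℕ} (hu : 1 ≤ u) (huv : u < v) (hv : v ≤ μ.card)
    (h1 : (hookBox μ v).1 = (hookBox μ u).1 + 1) (h2 : (hookBox μ v).2 = (hookBox μ u).2)
    (hs : 1 ≤ s) (hs' : s ≤ μ.card) (h3 : (hookBox μ s).1 = (hookBox μ u).1)
    (h4 : (hookBox μ s).2 + 1 = μ.rowLen (hookBox μ u).1) (hc : 0 ≤ content (hookBox μ v)) :
    ∃ i p m w, ColumnPosition μ i p m s w ∧ u = p + m + 1 ∧ v = w + m := by
  rcases hbu : hookBox μ u with ⟨i, j⟩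
  rcases hbv : hookBox μ v with ⟨i', j'⟩
  rcases hbs : hookBox μ s with ⟨i'', l⟩
  simp only [hbu, hbv, hbs, content] at h1 h2 h3 h4 hc
  subst h1 h2 h3
  obtain ⟨m, rfl⟩ : ∃ m, j' = i'' + 1 + m := ⟨j' - i'' - 1, by omega⟩
  have mu : (i'', i'' + 1 + m) ∈ μ := by rw [← hbu]; exact hookBox_mem hu (by omega)
  have mv : (i'' + 1, i'' + 1 + m) ∈ μ := by rw [← hbv]; exact hookBox_mem (by omega) hv
  have hl : i'' + 1 + m ≤ l := by
    have := YoungDiagram.mem_iff_lt_rowLen.1 mu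
    omega
  obtain ⟨r, hr, hr', hbr⟩ := exists_hookBox_eq
    (μ.up_left_mem (le_refl i'') (by omega : i'' + 1 ≤ i'' + 1 + m) mu)
  have top := fun t (ht : t ≤ m) => hookBox_add_right hr hr' hbr (by omega) t
    (μ.up_left_mem (le_refl i'') (by omega : i'' + 1 + t ≤ i'' + 1 + m) mu)
  have hru : r + m = u := hookBox_injective (by omega) (top m le_rfl).1 hu (by omega)
    (by rw [(top m le_rfl).2, hbu])
  have corner := hookBox_succ_hook hs hs' hbs (by omega) h4
    (μ.up_left_mem (le_refl (i'' + 1)) (by omega : i'' + 1 ≤ i'' + 1 + m) mv)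
  have hus : u ≤ s := by
    by_contra hlt
    have := hookBox_lt (μ := μ) hs (not_le.1 hlt) (by omega)
    rw [hbs, hbu] at this
    simp only [HookLt] at this
    omega
  obtain ⟨w, hw, hsw, hbot⟩ : ∃ w, w + m = v ∧ s < w ∧ ∀ t, 1 ≤ t → t ≤ m →
      hookBox μ (w + t) = (i'' + 1, i'' + 1 + t) := by
    -- For `m = 0` the letter `v` is the corner of its hook and the condition on the row part is
    -- empty, so `w = v` serves.
    rcases Nat.eq_zero_or_pos m with rfl | hm
    · refine ⟨v, rfl, ?_, fun t h1 h2 => by omega⟩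
      refine lt_of_hookBox_lt hs' (by omega) ?_
      rw [hbs, hbv]
      simp only [HookLt]; omega
    · obtain ⟨x, hx, hx', hbx⟩ := exists_hookBox_eq
        (μ.up_left_mem (le_refl (i'' + 1)) (by omega : i'' + 1 + 1 ≤ i'' + 1 + m) mv)
      have bot := fun t (ht : t + 1 ≤ m) => hookBox_add_right hx hx' hbx (by omega) t
        (μ.up_left_mem (le_refl (i'' + 1)) (by omega : i'' + 1 + 1 + t ≤ i'' + 1 + m) mv)
      have hxv : x + (m - 1) = v := by
        refine hookBox_injective (by omega) (bot (m - 1) (by omega)).1 (by omega) hv ?_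
        rw [(bot (m - 1) (by omega)).2, hbv, Prod.mk.injEq]
        omega
      have hsx : s + 1 < x := by
        refine lt_of_hookBox_lt corner.1 hx ?_
        rw [corner.2, hbx]
        simp only [HookLt]; omega
      refine ⟨x - 1, by omega, by omega, fun t h1 h2 => ?_⟩
      have := (bot (t - 1) (by omega)).2
      rw [show x - 1 + t = x + (t - 1) by omega, this, Prod.mk.injEq]
      omega
  refine ⟨i'', r - 1, m, w, ⟨by omega, hsw, by omega, fun t ht1 ht2 => ?_, ?_, corner.2, hbot, ?_⟩,
    by omega, hw.symm⟩
  · have := (top (t - 1) (by omega)).2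
    rw [show r - 1 + t = r + (t - 1) by omega, this, Prod.mk.injEq]
    omega
  · rw [hbs]; simp only [hookIndex]; omega
  · rw [hw, hbv]

theorem eq_succ_of_content_neg {u v : ℕ} (hu : 1 ≤ u) (huv : u < v) (hv : v ≤ μ.card)
    (h1 : (hookBox μ v).1 = (hookBox μ u).1 + 1) (h2 : (hookBox μ v).2 = (hookBox μ u).2)
    (hc : content (hookBox μ v) < 0) :
    v = u + 1 ∧ hookIndex (hookBox μ u) = hookIndex (hookBox μ v) := by
  have hm := hookBox_mem (μ := μ) (a := v) (by omega) hv
  rcases hbu : hookBox μ u with ⟨i, j⟩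
  rcases hbv : hookBox μ v with ⟨i', j'⟩
  simp only [hbu, hbv, content] at h1 h2 hc hm
  subst h1 h2
  obtain ⟨h3, h4⟩ := hookBox_succ_down hu (by omega) hbu (by omega) hm
  exact ⟨hookBox_injective (by omega) hv (by omega) h3 (by rw [hbv, h4]), by
    simp only [hookIndex]; omega⟩

theorem ratFunc_X_zpow_ne_one {k : ℤ} (hk : k ≠ 0) : (RatFunc.X : RatFunc ℂ) ^ k ≠ 1 := by
  have key : ∀ m : ℕ, m ≠ 0 → (RatFunc.X : RatFunc ℂ) ^ m ≠ 1 := by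
    intro m hm h
    rw [← RatFunc.algebraMap_X, ← map_pow, ← map_one (algebraMap (Polynomial ℂ) (RatFunc ℂ))] at h
    have := RatFunc.algebraMap_injective ℂ h
    have := congrArg Polynomial.natDegree this
    simp at this
    exact hm this
  rcases Int.natAbs_eq k with h | h
  · rw [h, zpow_natCast]
    exact key _ (by omega)
  · rw [h, zpow_neg, zpow_natCast]
    intro h'
    exact key _ (by omega) (inv_eq_one.1 h')

end Main

end HookFusion

theorem proposition2p7 (q : RatFunc ℂ) (hq : q = RatFunc.X) (μ : YoungDiagram) :
    (∃! F : HookFusion.Hecke q μ.card, HookFusion.IsFusionElement q μ F) ∧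
    ∀ F : HookFusion.Hecke q μ.card, HookFusion.IsFusionElement q μ F →
      ∀ u v s : ℕ, 1 ≤ u → u < v → v ≤ μ.card →
        -- `v` stands directly below `u`
        (HookFusion.hookBox μ v).1 = (HookFusion.hookBox μ u).1 + 1 →
        (HookFusion.hookBox μ v).2 = (HookFusion.hookBox μ u).2 →
        -- `s` is the last entry of the row containing `u`
        1 ≤ s → s ≤ μ.card →
        (HookFusion.hookBox μ s).1 = (HookFusion.hookBox μ u).1 →
        (HookFusion.hookBox μ s).2 + 1 = μ.rowLen (HookFusion.hookBox μ u).1 →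
        (HookFusion.content (HookFusion.hookBox μ v) < 0 →
          HookFusion.factor q μ.card u (q ^ (2 * HookFusion.content (HookFusion.hookBox μ u)))
              (q ^ (2 * HookFusion.content (HookFusion.hookBox μ v))) =
            HookFusion.T q μ.card u - algebraMap (RatFunc ℂ) (HookFusion.Hecke q μ.card) q ∧
          ∃ Y : HookFusion.Hecke q μ.card,
            F = (HookFusion.T q μ.card u -
              algebraMap (RatFunc ℂ) (HookFusion.Hecke q μ.card) q) * Y) ∧
        (0 ≤ HookFusion.content (HookFusion.hookBox μ v) →
          ∃ Y : HookFusion.Hecke q μ.card, F = HookFusion.columnDivisor q μ u v s * Y) := by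
  have hq0 : q ≠ 0 := by rw [hq]; exact RatFunc.X_ne_zero
  have hroot : ∀ k : ℤ, k ≠ 0 → q ^ k ≠ 1 := fun k hk => by
    rw [hq]; exact HookFusion.ratFunc_X_zpow_ne_one hk
  refine ⟨?_, ?_⟩
  · obtain ⟨F, hF⟩ := HookFusion.exists_isFusionElement (μ := μ) hq0 hroot
    exact ⟨F, hF, fun G hG => HookFusion.regularValue_unique hq0 hroot hG.hasRegularValue
      hF.hasRegularValue⟩
  · intro F hF u v s hu huv hv h1 h2 hs hs' h3 h4
    have hcont : HookFusion.content (HookFusion.hookBox μ v) =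
        HookFusion.content (HookFusion.hookBox μ u) - 1 := by
      simp only [HookFusion.content, h1, h2]
      push_cast
      ring
    refine ⟨fun hc => ⟨?_, ?_⟩, fun hc => ?_⟩
    · have := HookFusion.factor_of_content_eq_sub_one (n := μ.card) (i := u) hq0 hroot hcont
        one_ne_zero
      simpa only [mul_one] using this
    · obtain ⟨rfl, hh⟩ := HookFusion.eq_succ_of_content_neg hu huv hv h1 h2 hc
      exact HookFusion.isFusionElement_eq_mul_of_content_neg hq0 hroot hF hu hv hcont hh
    · obtain ⟨i, p, m, w, h, rfl, rfl⟩ :=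
        HookFusion.exists_columnPosition hu huv hv h1 h2 hs hs' h3 h4 hc
      exact HookFusion.isFusionElement_eq_columnDivisor_mul hq0 hroot hF h
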